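/- Let $0<s<1$. Let $X_s^+$ be the surface with boundary obtained from the rectangle $[1-s,1]\times[0,1]$ by identifying the bottom and top edges by the vertical translation (the resulting edge is called $B$) and by identifying the right edge $\{1\}\times[0,1]$ with the lower part $\{1-s\}\times[0,s]$ of the left edge by $(1,y)\sim(1-s,sy)$ (the resulting edge is called $A$); the rest $\{1-s\}\times[s,1]$ of the left edge is the boundary edge $E$, and the four corners and $(1-s,s)$ all represent one singular point. A forward trajectory of slope $m\in\mathbb R$ is a curve $\tau:[0,\infty)\to X_s^+$ (starting anywhere, possibly at the singular point, but not meeting it at positive times) which in local charts is a straight line of slope $m$ traversed from left to right with locally constant speed; its cutting sequence $c=c_1c_2\cdots$ is the sequence of the edges $A$, $B$ that it meets at times $0<t_1<t_2<\cdots$. Cutting sequences of forward trajectories on the square torus $T^2=\mathbb R^2/\mathbb Z^2$ are defined in the same way ($A$ the vertical and $B$ the horizontal side of the unit square), for trajectories that do not meet the corner at positive times; a trajectory of positive slope that starts at the corner may be regarded as entering its first square through the bottom edge, and then a letter $B$ is written in front. For $x\in\mathbb R$ put $$\Delta_s^-(x)=\Big(\frac{1-s}{s}\Big)^2\sum_{j=1}^\infty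 s^j\lceil jx\rceil,\qquad \Delta_s^+(x)=\frac{1-s}{s}+\Big(\frac{1-s}{s}\Big)^2\sum_{j=1}^\infty s^j\lfloor jx\rfloor .$$ Let $C_s\subset\mathbb R$ be the closure of the union of the images of $\Delta_s^-$ and $\Delta_s^+$, let $U_s=\mathbb R\setminus C_s$, and let $C_s'=\{\Delta_s^{\pm}(r): r\in\mathbb Q\}$. Let $\tau$ be a forward trajectory on $X_s^+$ with slope $m\in\mathbb R$ and cutting sequence $c$. (i) If $m\in U_s\cup C_s'$, then there exist $k/n\in\mathbb Q$ and a trajectory on $T^2$ of slope $k/n$ with cutting sequence $d$ such that $c_j=d_j$ for all sufficiently large $j$. (ii) If $m\in C_s\setminus C_s'$, then there exists $\xi\notin\mathbb Q$ such that $c$ is the cutting sequence of a trajectory on $T^2$ of slope $\xi$. -/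

import Mathlib

open Set Filter Topology

noncomputable section

namespace HomothetySurface

/-! ### Cutting sequences -/

/-- The two letters: `A` labels the vertical edge and `B` labels the horizontal edge. -/
inductive Letter : Type
  | A : Letter
  | B : Letter

/-- `c` is the (infinite) cutting sequence of the curve `τ`, observed for times `u ≥ 0`, with
respect to the edges `e A` and `e B`: the positive times at which `τ` meets an edge form a sequence
`0 < t 0 < t 1 < ⋯`, and at the time `t j` the curve meets the edge with label `c j` (and only that
one). -/
def IsCuttingSequence {X : Type*} (e : Letter → Set X) (τ : ℝ → X) (c : ℕ → Letter) : Prop :=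
  ∃ t : ℕ → ℝ, StrictMono t ∧
    (∀ u : ℝ, u ∈ range t ↔ (0 < u ∧ ∃ L : Letter, τ u ∈ e L)) ∧
    (∀ (j : ℕ) (L : Letter), τ (t j) ∈ e L ↔ c j = L)

/-! ### The surface `X_s⁺` -/

/-- The closed rectangle of width `s` and height `1`, placed as `[1 - s, 1] × [0, 1]`. -/
def Rect (s : ℝ) : Set (ℝ × ℝ) := Icc (1 - s) 1 ×ˢ Icc 0 1

/-- The edge identifications of the rectangle. The bottom edge is identified with the top edge by a
vertical translation; the right edge (of length `1`) is identified with the lower part (of length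
`s`) of the left edge by the direct homothety that takes top to top and bottom to bottom. The upper
part of the left edge (of length `1 - s`) is left free; it is the edge `E`. -/
inductive Glue (s : ℝ) : Rect s → Rect s → Prop
  | horizontal (p q : Rect s) (hx : p.1.1 = q.1.1) (hp : p.1.2 = 0) (hq : q.1.2 = 1) : Glue s p q
  | vertical (p q : Rect s) (hp : p.1.1 = 1) (hq : q.1.1 = 1 - s) (hy : q.1.2 = s * p.1.2) :
      Glue s p q

/-- The surface with boundary `X_s⁺`: the quotient of the rectangle by the equivalence relation
generated by the edge identifications. -/
def XPlus (s : ℝ) : Type := Quot (Glue s)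

/-- The point of `X_s⁺` represented by a point of the rectangle. -/
def proj (s : ℝ) (p : Rect s) : XPlus s := Quot.mk (Glue s) p

/-- The edges of `X_s⁺`: `A` is the image of the right edge of the rectangle, `B` is the image of
its top edge. -/
def edge (s : ℝ) : Letter → Set (XPlus s)
  | Letter.A => {x | ∃ p : Rect s, p.1.1 = 1 ∧ proj s p = x}
  | Letter.B => {x | ∃ p : Rect s, p.1.2 = 1 ∧ proj s p = x}

/-- The five points of the rectangle that represent the singular point: the four corners, and the
point that separates the glued part of the left edge from the free part. -/
def IsVertex (s : ℝ) (p : ℝ × ℝ) : Prop :=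
  ((p.1 = 1 - s ∨ p.1 = 1) ∧ (p.2 = 0 ∨ p.2 = 1)) ∨ p = (1 - s, s)

/-- Directly after the time `t`, the curve `τ` runs in the rectangle from the point `p` to the
right, in a straight line, with velocity `v • (1, m)`. -/
def StartsAlong (s m : ℝ) (τ : ℝ → XPlus s) (t : ℝ) (p : ℝ × ℝ) (v : ℝ) : Prop :=
  0 < v ∧ ∃ ε > 0, ∀ u : ℝ, 0 ≤ u → u < ε →
    ∃ h : p + (u * v) • ((1 : ℝ), m) ∈ Rect s, τ (t + u) = proj s ⟨p + (u * v) • ((1 : ℝ), m), h⟩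

/-- Directly before the time `t`, the curve `τ` runs in the rectangle towards the point `q`, from
the left, in a straight line, with velocity `v • (1, m)`. -/
def ArrivesAlong (s m : ℝ) (τ : ℝ → XPlus s) (t : ℝ) (q : ℝ × ℝ) (v : ℝ) : Prop :=
  0 < v ∧ ∃ ε > 0, ∀ u : ℝ, 0 ≤ u → u < ε →
    ∃ h : q - (u * v) • ((1 : ℝ), m) ∈ Rect s, τ (t - u) = proj s ⟨q - (u * v) • ((1 : ℝ), m), h⟩

/-- A straight line arriving at the point `q` of the rectangle with velocity `v • (1, m)` is
continued, in a chart of the surface around the nonsingular point represented by `q`, by the line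
leaving from `p` with velocity `v' • (1, m)`: either `p = q`, or `p` is glued to `q` along the edge
`A` (by a homothety of derivative `s`, from the right edge to the left edge) or along the edge `B`
(by a translation). -/
def Continues (s : ℝ) (q : ℝ × ℝ) (v : ℝ) (p : ℝ × ℝ) (v' : ℝ) : Prop :=
  ¬ IsVertex s q ∧
    ((p = q ∧ v' = v) ∨
      (q.1 = 1 ∧ p = (1 - s, s * q.2) ∧ v' = s * v) ∨
      (q.2 = 1 ∧ p = (q.1, 0) ∧ v' = v) ∨
      (q.2 = 0 ∧ p = (q.1, 1) ∧ v' = v))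

/-- `τ`, restricted to `[0, ∞)`, is a forward linear trajectory of slope `m` on `X_s⁺`: at time `0`
it leaves some point of `X_s⁺` (possibly the singular point) in the forward direction, and at every
positive time it is at a nonsingular point, where it is a straight line of slope `m` traversed
forward with constant velocity in a chart. -/
def IsForwardTrajectory (s m : ℝ) (τ : ℝ → XPlus s) : Prop :=
  (∃ p v, StartsAlong s m τ 0 p v) ∧
    ∀ t : ℝ, 0 < t → ∃ q v p v',
      ArrivesAlong s m τ t q v ∧ Continues s q v p v' ∧ StartsAlong s m τ t p v'

/-! ### The square torus -/

/-- The square torus `ℝ² / ℤ²`. -/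
abbrev Torus : Type := UnitAddCircle × UnitAddCircle

/-- The edges of the torus: `A` is the image of the vertical sides of the unit square, `B` is the
image of its horizontal sides. -/
def torusEdge : Letter → Set Torus
  | Letter.A => {x | x.1 = 0}
  | Letter.B => {x | x.2 = 0}

/-- `γ` is a forward linear trajectory of slope `ξ` on the square torus. -/
def IsTorusTrajectory (ξ : ℝ) (γ : ℝ → Torus) : Prop :=
  ∃ a b v : ℝ, 0 < v ∧
    ∀ t : ℝ, γ t = (((a + t * v : ℝ) : UnitAddCircle), ((b + t * v * ξ : ℝ) : UnitAddCircle))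

/-- `d` is a cutting sequence of a forward trajectory of slope `ξ` on the square torus. The
trajectory does not pass through the corner of the square at positive times. If it starts at the
corner and `ξ > 0`, it may be regarded as entering the first square through its bottom edge, and
then the letter `B` is recorded for the time `0`. -/
def IsTorusCuttingSequence (ξ : ℝ) (d : ℕ → Letter) : Prop :=
  ∃ γ : ℝ → Torus, IsTorusTrajectory ξ γ ∧
    (IsCuttingSequence torusEdge γ d ∨
      (0 < ξ ∧ γ 0 = 0 ∧ d 0 = Letter.B ∧
        IsCuttingSequence torusEdge γ (fun j => d (j + 1))))

/-! ### The sets of slopes -/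

/-- `Δ_s⁻(x) = ((1 - s) / s)² ∑_{j ≥ 1} s^j ⌈j x⌉`. -/
def deltaMinus (s x : ℝ) : ℝ :=
  ((1 - s) / s) ^ 2 * ∑' j : ℕ, s ^ (j + 1) * (⌈((j + 1 : ℕ) : ℝ) * x⌉ : ℝ)

/-- `Δ_s⁺(x) = (1 - s) / s + ((1 - s) / s)² ∑_{j ≥ 1} s^j ⌊j x⌋`. -/
def deltaPlus (s x : ℝ) : ℝ :=
  (1 - s) / s + ((1 - s) / s) ^ 2 * ∑' j : ℕ, s ^ (j + 1) * (⌊((j + 1 : ℕ) : ℝ) * x⌋ : ℝ)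

/-- The set `C_s`: the closure of the union of the images of `Δ_s⁻` and `Δ_s⁺`. -/
def slopesC (s : ℝ) : Set ℝ := closure (range (deltaMinus s) ∪ range (deltaPlus s))

/-- The set `U_s`: the complement of `C_s`. -/
def slopesU (s : ℝ) : Set ℝ := (slopesC s)ᶜ

/-- The set `C'_s`: the values of `Δ_s⁻` and `Δ_s⁺` at rational numbers. -/
def slopesC' (s : ℝ) : Set ℝ :=
  {m | ∃ r : ℚ, m = deltaMinus s (r : ℝ) ∨ m = deltaPlus s (r : ℝ)}

end HomothetySurface

end

/-! A cutting sequence is determined by the numbers of letters `B` before the first `A` and between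
consecutive `A`s. On `X_s⁺`, a trajectory that arrives at the right edge at height `L` mod 1
re-enters at height `s * fract L` and rises by `s * m` while crossing the rectangle. The lifted
arrival heights therefore evolve under `F L = (1 - s)⌊L⌋ + s L + s m` (`returnLift`), and the next
leg crosses `B` exactly `|⌊F L⌋ - ⌊L⌋|` times. Corners are singular, so the orbit avoids the
integers (`exists_legs`). On the torus the arrival heights evolve under translation by the slope
(`torusLine_legs`). The task is to find a translation orbit `y + k ρ` with the same integer parts as
a given `F`-orbit.

Termwise comparison shows that the intervals `[Δ⁻(ρ), Δ⁺(ρ)]` are ordered along the line, and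
one-sided limits show that they cover it (`exists_rotation`). Irrational `ρ` give single points; the
slopes in `U_s ∪ C'_s` belong to rational `ρ`, those in `C_s \ C'_s` only to irrational ones. For
`m` in the interval of `ρ`, the explicit monotone function `phi` commutes with integer translations,
satisfies `⌊z⌋ ≤ phi z ≤ ⌊z⌋ + 1`, and intertwines translation by `ρ` with `F`. Hence an `F`-orbit
off the integers stays squeezed between the values of `phi` on the two sides of some `y + k ρ`
(`exists_phase`), and the integer parts agree unless `y + k ρ` is an integer.

For irrational `ρ` such a tie is impossible, because `phi` is continuous and equal to the identity
at the integers; only the first, incomplete leg needs care (`irrational_cutting`). For `ρ = p/q`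
ties recur along one residue class mod `q`. There the integer part can take two values, and since
`F^q - p` is monotone, its choice eventually stabilizes; moving `y` by `±1/(2q)` reproduces that
choice (`exists_eventually_floor_eq`). -/

namespace HomothetySurface

/-! ### Labelled events on the half line -/

/-- `c` lists in order the labels of the events `E` at positive times. -/
def Cut (E : ℝ → Letter → Prop) (c : ℕ → Letter) : Prop :=
  ∃ t : ℕ → ℝ, StrictMono t ∧
    (∀ u : ℝ, u ∈ range t ↔ (0 < u ∧ ∃ L : Letter, E u L)) ∧
    (∀ (j : ℕ) (L : Letter), E (t j) L ↔ c j = L)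

/-- The positive times are divided into legs `(T k, T (k + 1)]`. In the interior of the leg `k`
there are exactly `n k` events, all with label `B`, and it ends with an event `A`. -/
structure Legs (E : ℝ → Letter → Prop) (T : ℕ → ℝ) (n : ℕ → ℕ) : Prop where
  zero : T 0 = 0
  mono : StrictMono T
  cover : ∀ u, 0 < u → ∃ k, u ∈ Ioc (T k) (T (k + 1))
  endA : ∀ k L, E (T (k + 1)) L ↔ L = Letter.A
  notA : ∀ k, ∀ u ∈ Ioo (T k) (T (k + 1)), ¬ E u Letter.A
  fin : ∀ k, {u ∈ Ioo (T k) (T (k + 1)) | E u Letter.B}.Finite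
  card : ∀ k, {u ∈ Ioo (T k) (T (k + 1)) | E u Letter.B}.ncard = n k

theorem exists_strictMonoOn_image {S S' : Set ℝ} (hS : S.Finite) (hS' : S'.Finite)
    (h : S.ncard = S'.ncard) : ∃ f : ℝ → ℝ, StrictMonoOn f S ∧ f '' S = S' := by
  classical
  obtain ⟨A, rfl⟩ := hS.exists_finset_coe
  obtain ⟨A', rfl⟩ := hS'.exists_finset_coe
  rw [ncard_coe_finset, ncard_coe_finset] at h
  let e := (A.orderIsoOfFin rfl).symm.trans (A'.orderIsoOfFin h.symm)
  refine ⟨fun u => if hu : u ∈ A then e ⟨u, hu⟩ else 0, ?_, ?_⟩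
  · intro x hx y hy hxy
    have hx' : x ∈ A := hx
    have hy' : y ∈ A := hy
    simp only [hx', hy', dif_pos]
    exact e.strictMono (show (⟨x, hx'⟩ : A) < ⟨y, hy'⟩ from hxy)
  · ext y
    constructor
    · rintro ⟨x, hx, rfl⟩
      have hx' : x ∈ A := hx
      simp only [hx', dif_pos]
      exact (e ⟨x, hx'⟩).2
    · intro hy
      refine ⟨e.symm ⟨y, hy⟩, (e.symm ⟨y, hy⟩).2, ?_⟩
      simp

theorem Legs.pos {E T n} (h : Legs E T n) (k : ℕ) : 0 ≤ T k := by
  rw [← h.zero]; exact h.mono.monotone (Nat.zero_le k)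

theorem Legs.leg_unique {E T n} (h : Legs E T n) {u : ℝ} {k l : ℕ}
    (hk : u ∈ Ioc (T k) (T (k + 1))) (hl : u ∈ Ioc (T l) (T (l + 1))) : k = l := by
  have h1 : k < l + 1 := h.mono.lt_iff_lt.1 (hk.1.trans_le hl.2)
  have h2 : l < k + 1 := h.mono.lt_iff_lt.1 (hl.1.trans_le hk.2)
  omega

/-- Two systems of legs with the same numbers of events have the same cutting sequence. -/
theorem Legs.cut {E E' : ℝ → Letter → Prop} {T T' : ℕ → ℝ} {n : ℕ → ℕ} {c : ℕ → Letter}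
    (h : Legs E T n) (h' : Legs E' T' n) (hc : Cut E c) : Cut E' c := by
  classical
  have hex : ∀ k, ∃ f : ℝ → ℝ, StrictMonoOn f {u ∈ Ioo (T k) (T (k + 1)) | E u Letter.B} ∧
      f '' {u ∈ Ioo (T k) (T (k + 1)) | E u Letter.B} =
        {u ∈ Ioo (T' k) (T' (k + 1)) | E' u Letter.B} := fun k =>
    exists_strictMonoOn_image (h.fin k) (h'.fin k) (by rw [h.card, h'.card])
  choose f hf hfi using hex
  have hleg : ∀ u, ∃ k, 0 < u → u ∈ Ioc (T k) (T (k + 1)) := fun u => by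
    by_cases hu : 0 < u
    · obtain ⟨k, hk⟩ := h.cover u hu
      exact ⟨k, fun _ => hk⟩
    · exact ⟨0, fun h => absurd h hu⟩
  choose κ hκ using hleg
  have hκe : ∀ {u k}, u ∈ Ioc (T k) (T (k + 1)) → κ u = k := fun {u k} hu =>
    h.leg_unique (hκ u ((h.pos k).trans_lt hu.1)) hu
  -- Leg ends go to leg ends and the `B`s inside a leg go to those of the corresponding leg in
  -- order. The values of `g` at times without events play no role.
  let g : ℝ → ℝ := fun u => if u = T (κ u + 1) then T' (κ u + 1) else f (κ u) u
  have hTmem : ∀ k, T (k + 1) ∈ Ioc (T k) (T (k + 1)) := fun k =>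
    ⟨h.mono (Nat.lt_succ_self k), le_rfl⟩
  have hgT : ∀ k, g (T (k + 1)) = T' (k + 1) := fun k => by
    simp only [g, hκe (hTmem k), if_true]
  have hgB : ∀ k, ∀ u ∈ Ioo (T k) (T (k + 1)), g u = f k u := fun k u hu => by
    simp only [g, hκe (⟨hu.1, hu.2.le⟩ : u ∈ Ioc (T k) (T (k + 1))), if_neg hu.2.ne]
  -- the position of an event
  have hcase : ∀ u, 0 < u → (∃ L, E u L) → ∃ k, u = T (k + 1) ∨
      u ∈ {u ∈ Ioo (T k) (T (k + 1)) | E u Letter.B} := by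
    rintro u hu ⟨L, hL⟩
    obtain ⟨k, hk⟩ := h.cover u hu
    rcases hk.2.eq_or_lt with he | hlt
    · exact ⟨k, Or.inl he⟩
    · refine ⟨k, Or.inr ⟨⟨hk.1, hlt⟩, ?_⟩⟩
      cases L
      · exact absurd hL (h.notA k u ⟨hk.1, hlt⟩)
      · exact hL
  have himg : ∀ k, ∀ u ∈ {u ∈ Ioo (T k) (T (k + 1)) | E u Letter.B},
      g u ∈ {u ∈ Ioo (T' k) (T' (k + 1)) | E' u Letter.B} := fun k u hu => by
    rw [hgB k u hu.1, ← hfi k]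
    exact mem_image_of_mem _ hu
  have hlab : ∀ u, 0 < u → (∃ L, E u L) → ∀ L, E u L ↔ E' (g u) L := by
    intro u hu he L
    obtain ⟨k, rfl | hk⟩ := hcase u hu he
    · rw [hgT, h.endA, h'.endA]
    · have h2 := himg k u hk
      cases L
      · exact iff_of_false (h.notA k u hk.1) (h'.notA k _ h2.1)
      · exact iff_of_true hk.2 h2.2
  have hIoc : ∀ u, 0 < u → (∃ L, E u L) → ∃ k, u ∈ Ioc (T k) (T (k + 1)) ∧
      g u ∈ Ioc (T' k) (T' (k + 1)) := by
    intro u hu he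
    obtain ⟨k, rfl | hk⟩ := hcase u hu he
    · exact ⟨k, hTmem k, by rw [hgT]; exact ⟨h'.mono (Nat.lt_succ_self k), le_rfl⟩⟩
    · exact ⟨k, ⟨hk.1.1, hk.1.2.le⟩, ⟨(himg k u hk).1.1, (himg k u hk).1.2.le⟩⟩
  have hmono : ∀ u w, 0 < u → (∃ L, E u L) → 0 < w → (∃ L, E w L) → u < w → g u < g w := by
    intro u w hu heu hw hew huw
    obtain ⟨k, hk, hgk⟩ := hIoc u hu heu
    obtain ⟨l, hl, hgl⟩ := hIoc w hw hew
    have hkl : k ≤ l := by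
      have : k < l + 1 := h.mono.lt_iff_lt.1 (hk.1.trans (huw.trans_le hl.2))
      omega
    rcases hkl.eq_or_lt with rfl | hlt
    · have hu1 : u ∈ Ioo (T k) (T (k + 1)) := ⟨hk.1, huw.trans_le hl.2⟩
      have huB : u ∈ {u ∈ Ioo (T k) (T (k + 1)) | E u Letter.B} := by
        obtain ⟨L, hL⟩ := heu
        cases L
        · exact absurd hL (h.notA k u hu1)
        · exact ⟨hu1, hL⟩
      rcases hl.2.eq_or_lt with he | hlt
      · rw [he, hgT]
        exact (himg k u huB).1.2
      · have hwB : w ∈ {u ∈ Ioo (T k) (T (k + 1)) | E u Letter.B} := by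
          obtain ⟨L, hL⟩ := hew
          cases L
          · exact absurd hL (h.notA k w ⟨hl.1, hlt⟩)
          · exact ⟨⟨hl.1, hlt⟩, hL⟩
        rw [hgB k u hu1, hgB k w hwB.1]
        exact hf k huB hwB huw
    · exact (hgk.2.trans (h'.mono.monotone hlt)).trans_lt hgl.1
  have hsurj : ∀ w, 0 < w → (∃ L, E' w L) → ∃ u, (0 < u ∧ ∃ L, E u L) ∧ g u = w := by
    rintro w hw ⟨L, hL⟩
    obtain ⟨k, hk⟩ := h'.cover w hw
    rcases hk.2.eq_or_lt with rfl | hlt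
    · exact ⟨T (k + 1), ⟨(h.pos k).trans_lt (hTmem k).1, Letter.A, (h.endA k _).2 rfl⟩, hgT k⟩
    · have hwB : w ∈ {u ∈ Ioo (T' k) (T' (k + 1)) | E' u Letter.B} := by
        cases L
        · exact absurd hL (h'.notA k w ⟨hk.1, hlt⟩)
        · exact ⟨⟨hk.1, hlt⟩, hL⟩
      rw [← hfi k] at hwB
      obtain ⟨u, hu, rfl⟩ := hwB
      exact ⟨u, ⟨(h.pos k).trans_lt hu.1.1, Letter.B, hu.2⟩, hgB k u hu.1⟩
  obtain ⟨t, ht, hr, hl⟩ := hc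
  have hev : ∀ j, 0 < t j ∧ ∃ L, E (t j) L := fun j => (hr _).1 (mem_range_self j)
  refine ⟨fun j => g (t j), fun i j hij => hmono _ _ (hev i).1 (hev i).2 (hev j).1 (hev j).2
    (ht hij), fun w => ⟨?_, ?_⟩, fun j L => ?_⟩
  · rintro ⟨j, rfl⟩
    obtain ⟨k, -, hgk⟩ := hIoc _ (hev j).1 (hev j).2
    obtain ⟨L, hL⟩ := (hev j).2
    exact ⟨(h'.pos k).trans_lt hgk.1, L, (hlab _ (hev j).1 (hev j).2 L).1 hL⟩
  · rintro ⟨hw, he⟩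
    obtain ⟨u, hu, rfl⟩ := hsurj w hw he
    obtain ⟨j, rfl⟩ := (hr u).2 hu
    exact ⟨j, rfl⟩
  · rw [← hl j L]
    exact (hlab _ (hev j).1 (hev j).2 L).symm

/-- Restarting the clock at the event number `r` drops the first `r + 1` letters. -/
theorem cut_shift {E : ℝ → Letter → Prop} {c : ℕ → Letter} {t : ℕ → ℝ} (ht : StrictMono t)
    (hr : ∀ u : ℝ, u ∈ range t ↔ (0 < u ∧ ∃ L : Letter, E u L))
    (hl : ∀ (j : ℕ) (L : Letter), E (t j) L ↔ c j = L) (r : ℕ) :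
    Cut (fun u => E (t r + u)) (fun j => c (j + (r + 1))) := by
  have hev : ∀ j, 0 < t j ∧ ∃ L, E (t j) L := fun j => (hr _).1 (mem_range_self j)
  refine ⟨fun j => t (j + (r + 1)) - t r, fun i j hij => ?_, fun u => ⟨?_, ?_⟩, fun j L => ?_⟩
  · have := ht (show i + (r + 1) < j + (r + 1) by omega)
    simp only
    linarith
  · rintro ⟨j, rfl⟩
    have := ht (show r < j + (r + 1) by omega)
    refine ⟨by simpa using this, ?_⟩
    simpa using (hev (j + (r + 1))).2
  · rintro ⟨hu, he⟩
    obtain ⟨i, hi⟩ := (hr (t r + u)).2 ⟨by linarith [(hev r).1], he⟩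
    have hri : r < i := ht.lt_iff_lt.1 (by rw [hi]; linarith)
    refine ⟨i - (r + 1), ?_⟩
    simp only
    rw [Nat.sub_add_cancel hri, hi]
    ring
  · rw [← hl]
    simp

theorem Legs.shift {E : ℝ → Letter → Prop} {T : ℕ → ℝ} {n : ℕ → ℕ} (h : Legs E T n) (r : ℕ) :
    Legs (fun u => E (T r + u)) (fun k => T (k + r) - T r) (fun k => n (k + r)) := by
  have hset : ∀ k, {u ∈ Ioo (T (k + r) - T r) (T (k + 1 + r) - T r) | E (T r + u) Letter.B} =
      (fun u => u - T r) '' {u ∈ Ioo (T (k + r)) (T (k + r + 1)) | E u Letter.B} := by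
    intro k
    ext u
    rw [show k + 1 + r = k + r + 1 by omega]
    constructor
    · rintro ⟨⟨h1, h2⟩, h3⟩
      exact ⟨T r + u, ⟨⟨by linarith, by linarith⟩, h3⟩, by ring⟩
    · rintro ⟨w, ⟨⟨h1, h2⟩, h3⟩, rfl⟩
      refine ⟨⟨by simpa using h1, by simpa using h2⟩, by simpa using h3⟩
  refine ⟨by simp, fun i j hij => ?_, fun u hu => ?_, fun k L => ?_, fun k u hu => ?_,
    fun k => ?_, fun k => ?_⟩
  · have := h.mono (show i + r < j + r by omega)
    change T (i + r) - T r < T (j + r) - T r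
    linarith
  · obtain ⟨k, hk⟩ := h.cover (T r + u) (by linarith [h.pos r])
    have : r < k + 1 := h.mono.lt_iff_lt.1 (by linarith [hk.2])
    refine ⟨k - r, ?_⟩
    rw [show k - r + 1 + r = k + 1 by omega, show k - r + r = k by omega]
    exact ⟨by linarith [hk.1], by linarith [hk.2]⟩
  · rw [show T r + (T (k + 1 + r) - T r) = T (k + r + 1) by
      rw [show k + 1 + r = k + r + 1 by omega]; ring]
    exact h.endA _ L
  · rw [show k + 1 + r = k + r + 1 by omega] at hu
    exact h.notA (k + r) _ ⟨by linarith [hu.1], by linarith [hu.2]⟩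
  · rw [hset]
    exact (h.fin _).image _
  · rw [hset, ncard_image_of_injective _ (fun a b hab => by simpa using hab), h.card]

/-- Restarting the clock at the first event, if this is a `B`, drops one event of the first leg. -/
theorem Legs.shift_first {E : ℝ → Letter → Prop} {T : ℕ → ℝ} {n : ℕ → ℕ} (h : Legs E T n)
    {t₀ : ℝ} (h0 : 0 < t₀) (hB : E t₀ Letter.B)
    (hfirst : ∀ u, 0 < u → (∃ L, E u L) → t₀ ≤ u) :
    Legs (fun u => E (t₀ + u)) (fun k => if k = 0 then 0 else T k - t₀)
      (fun k => if k = 0 then n 0 - 1 else n k) := by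
  have hle : t₀ ≤ T 1 := hfirst _ (by rw [← h.zero]; exact h.mono one_pos) ⟨_, (h.endA 0 _).2 rfl⟩
  have hlt : t₀ < T 1 := by
    refine hle.lt_of_ne fun he => ?_
    rw [he, h.endA 0] at hB
    exact absurd hB (by simp)
  have hset : ∀ k, k ≠ 0 → {u ∈ Ioo (T k - t₀) (T (k + 1) - t₀) | E (t₀ + u) Letter.B} =
      (fun u => u - t₀) '' {u ∈ Ioo (T k) (T (k + 1)) | E u Letter.B} := by
    intro k _
    ext u
    constructor
    · rintro ⟨⟨h1, h2⟩, h3⟩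
      exact ⟨t₀ + u, ⟨⟨by linarith, by linarith⟩, h3⟩, by ring⟩
    · rintro ⟨w, ⟨⟨h1, h2⟩, h3⟩, rfl⟩
      refine ⟨⟨by simpa using h1, by simpa using h2⟩, by simpa using h3⟩
  have hset0 : {u ∈ Ioo 0 (T 1 - t₀) | E (t₀ + u) Letter.B} =
      (fun u => u - t₀) '' ({u ∈ Ioo (T 0) (T 1) | E u Letter.B} \ {t₀}) := by
    ext u
    constructor
    · rintro ⟨⟨h1, h2⟩, h3⟩
      exact ⟨t₀ + u, ⟨⟨⟨by rw [h.zero]; linarith, by linarith⟩, h3⟩, by simp [h1.ne']⟩, by ring⟩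
    · rintro ⟨w, ⟨⟨⟨h1, h2⟩, h3⟩, h4⟩, rfl⟩
      rw [h.zero] at h1
      have := (hfirst w h1 ⟨_, h3⟩).lt_of_ne (Ne.symm h4)
      refine ⟨⟨by simpa using this, by simpa using h2⟩, by simpa using h3⟩
  have hmem : t₀ ∈ {u ∈ Ioo (T 0) (T 1) | E u Letter.B} := ⟨⟨by rw [h.zero]; exact h0, hlt⟩, hB⟩
  have hT1 : ∀ k, k ≠ 0 → t₀ < T k := fun k hk =>
    hlt.trans_le (h.mono.monotone (Nat.one_le_iff_ne_zero.2 hk))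
  refine ⟨by simp, strictMono_nat_of_lt_succ fun k => ?_, fun u hu => ?_, fun k L => ?_,
    fun k u hu => ?_, fun k => ?_, fun k => ?_⟩
  · rcases eq_or_ne k 0 with rfl | hk
    · simpa using hlt
    · simpa [hk] using h.mono (Nat.lt_succ_self k)
  · obtain ⟨k, hk⟩ := h.cover (t₀ + u) (by linarith)
    refine ⟨k, ?_⟩
    rcases eq_or_ne k 0 with rfl | hk0
    · simp only [if_true, zero_add, one_ne_zero, if_false] at hk ⊢
      exact ⟨hu, by linarith [hk.2]⟩
    · simp only [hk0, if_false, Nat.succ_ne_zero]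
      exact ⟨by linarith [hk.1], by linarith [hk.2]⟩
  · simp only [Nat.succ_ne_zero, if_false]
    rw [show t₀ + (T (k + 1) - t₀) = T (k + 1) by ring]
    exact h.endA k L
  · rcases eq_or_ne k 0 with rfl | hk0
    · simp only [if_true, zero_add, one_ne_zero, if_false] at hu
      exact h.notA 0 _ ⟨by rw [h.zero]; linarith [hu.1], by rw [zero_add]; linarith [hu.2]⟩
    · simp only [hk0, if_false, Nat.succ_ne_zero] at hu
      exact h.notA k _ ⟨by linarith [hu.1], by linarith [hu.2]⟩
  · rcases eq_or_ne k 0 with rfl | hk0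
    · simp only [if_true, zero_add, one_ne_zero, if_false]
      rw [hset0]
      exact ((h.fin 0).subset sdiff_subset).image _
    · simp only [hk0, if_false, Nat.succ_ne_zero]
      rw [hset k hk0]
      exact (h.fin _).image _
  · rcases eq_or_ne k 0 with rfl | hk0
    · simp only [if_true, zero_add, one_ne_zero, if_false]
      rw [hset0, ncard_image_of_injective _ (fun a b hab => by simpa using hab),
        ncard_sdiff_singleton_of_mem hmem]
      congr 1
      exact h.card 0
    · simp only [hk0, if_false, Nat.succ_ne_zero]
      rw [hset k hk0, ncard_image_of_injective _ (fun a b hab => by simpa using hab), h.card]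

/-! ### Counting the integer levels crossed by a segment -/

/-- The number of integers strictly between `H` and `Y`. -/
noncomputable def cnt (H Y : ℝ) : ℕ := {N : ℤ | (H < N ∧ N < Y) ∨ (Y < N ∧ N < H)}.ncard

/-- `x` is not an integer. -/
def NonInt (x : ℝ) : Prop := ∀ N : ℤ, x ≠ N

theorem NonInt.floor_lt {x : ℝ} (h : NonInt x) : (⌊x⌋ : ℝ) < x :=
  (Int.floor_le x).lt_of_ne (h _).symm

theorem NonInt.lt_iff {x : ℝ} (h : NonInt x) (N : ℤ) : (N : ℝ) < x ↔ N ≤ ⌊x⌋ :=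
  ⟨fun h' => Int.le_floor.2 h'.le, fun h' => (Int.le_floor.1 h').lt_of_ne (h N).symm⟩

/-- Only the end is kept off the integers: `H` may be the starting height 0 on the edge `B`, and the
start itself is not counted. -/
theorem cnt_eq_of_lt {H Y : ℝ} (hY : NonInt Y) (h : H ≤ Y) : cnt H Y = (⌊Y⌋ - ⌊H⌋).toNat := by
  have : {N : ℤ | (H < N ∧ N < Y) ∨ (Y < N ∧ N < H)} = (Finset.Ioc ⌊H⌋ ⌊Y⌋ : Finset ℤ) := by
    ext N
    simp only [mem_ofPred_eq, Finset.coe_Ioc, mem_Ioc, hY.lt_iff, Int.floor_lt]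
    constructor
    · rintro (h1 | h1)
      · exact h1
      · linarith [h1.1, h1.2]
    · exact Or.inl
  rw [cnt, this, ncard_coe_finset, Int.card_Ioc]

/-- The form `⌈H⌉ - 1` allows a descent that starts at an integer level, such as height 1, again
without counting the start. -/
theorem cnt_eq_of_gt {H Y : ℝ} (h : Y ≤ H) :
    cnt H Y = (⌈H⌉ - 1 - ⌊Y⌋).toNat := by
  have : {N : ℤ | (H < N ∧ N < Y) ∨ (Y < N ∧ N < H)} = (Finset.Ioc ⌊Y⌋ (⌈H⌉ - 1) : Finset ℤ) := by
    ext N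
    simp only [mem_ofPred_eq, Finset.coe_Ioc, mem_Ioc, Int.floor_lt, Int.le_sub_one_iff,
      Int.lt_ceil]
    constructor
    · rintro (h1 | h1)
      · linarith [h1.1, h1.2]
      · exact h1
    · exact Or.inr
  rw [cnt, this, ncard_coe_finset, Int.card_Ioc]

theorem NonInt.ceil_eq {x : ℝ} (h : NonInt x) : ⌈x⌉ = ⌊x⌋ + 1 := by
  rw [Int.ceil_eq_iff]
  push_cast
  exact ⟨by linarith [h.floor_lt], (Int.lt_floor_add_one x).le⟩

theorem cnt_eq_natAbs {H Y : ℝ} (hH : NonInt H) (hY : NonInt Y) :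
    cnt H Y = (⌊Y⌋ - ⌊H⌋).natAbs := by
  rcases le_total H Y with h | h
  · rw [cnt_eq_of_lt hY h]
    have := Int.floor_le_floor h
    omega
  · rw [cnt_eq_of_gt h, hH.ceil_eq]
    have := Int.floor_le_floor h
    omega

/-- For `σ ≠ 0` the times of crossing and the integer levels correspond through an affine bijection.
For `σ = 0` the height is constantly equal to its non-integral end value, so both sides are empty.
-/
theorem affine_levels {a b H σ : ℝ} (hab : a < b) (hY : NonInt (H + (b - a) * σ)) :
    {u ∈ Ioo a b | ∃ N : ℤ, H + (u - a) * σ = N}.Finite ∧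
    {u ∈ Ioo a b | ∃ N : ℤ, H + (u - a) * σ = N}.ncard = cnt H (H + (b - a) * σ) := by
  rcases eq_or_ne σ 0 with rfl | hσ
  · have hH : NonInt H := by simpa using hY
    have : {u ∈ Ioo a b | ∃ N : ℤ, H + (u - a) * 0 = N} = ∅ := by
      ext u
      simp only [mul_zero, add_zero, mem_ofPred_eq, mem_empty_iff_false, iff_false]
      rintro ⟨-, N, hN⟩
      exact hH N hN
    rw [this, cnt_eq_natAbs hH hY]
    simp
  · have himg : {u ∈ Ioo a b | ∃ N : ℤ, H + (u - a) * σ = N} = (fun N : ℤ => a + (N - H) / σ) ''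
        {N : ℤ | (H < N ∧ N < H + (b - a) * σ) ∨ (H + (b - a) * σ < N ∧ N < H)} := by
      ext u
      constructor
      · rintro ⟨⟨h1, h2⟩, N, hN⟩
        refine ⟨N, ?_, ?_⟩
        · simp only [mem_ofPred_eq, ← hN]
          rcases hσ.lt_or_gt with h | h
          · right
            constructor <;> nlinarith
          · left
            constructor <;> nlinarith
        · simp only [← hN]
          field_simp
          ring
      · rintro ⟨N, hN, rfl⟩
        refine ⟨?_, N, by field_simp; ring⟩
        rcases hσ.lt_or_gt with h | h
        · rcases hN with hN | hN
          · nlinarith [hN.1, hN.2]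
          · constructor
            · have := div_pos_of_neg_of_neg (show (N : ℝ) - H < 0 by linarith [hN.2]) h
              simp only
              linarith
            · have := (div_lt_iff_of_neg h (b := (N : ℝ) - H) (a := b - a)).2 (by linarith [hN.1])
              simp only
              linarith
        · rcases hN with hN | hN
          · constructor
            · have := div_pos (show 0 < (N : ℝ) - H by linarith [hN.1]) h
              simp only
              linarith
            · have := (div_lt_iff₀ h).2 (show (N : ℝ) - H < (b - a) * σ by linarith [hN.2])
              simp only
              linarith
          · nlinarith [hN.1, hN.2]
    have hfin : {N : ℤ | (H < N ∧ N < H + (b - a) * σ) ∨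
        (H + (b - a) * σ < N ∧ N < H)}.Finite := by
      refine ((Finset.Ioc ⌊H⌋ ⌊H + (b - a) * σ⌋ ∪
        Finset.Ioc ⌊H + (b - a) * σ⌋ (⌈H⌉ - 1) : Finset ℤ).finite_toSet).subset ?_
      intro N hN
      simp only [mem_ofPred_eq] at hN
      simp only [Finset.coe_union, Finset.coe_Ioc, mem_union, mem_Ioc, Int.floor_lt,
        Int.le_sub_one_iff, Int.lt_ceil, ← hY.lt_iff]
      exact hN
    rw [himg]
    refine ⟨hfin.image _, ?_⟩
    rw [ncard_image_of_injective, cnt]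
    intro x y hxy
    have : ((x : ℝ) - H) / σ = (y - H) / σ := by simpa using hxy
    rw [div_left_inj' hσ] at this
    exact_mod_cast (sub_left_inj.1 this)

/-! ### Points of the surface in coordinates -/

/-- `q` is the point of the surface with abscissa `x` and with height `Y` modulo `1`. -/
def IsPt (s x Y : ℝ) (q : XPlus s) : Prop :=
  ∃ h : ((x, Int.fract Y) : ℝ × ℝ) ∈ Rect s, q = proj s ⟨(x, Int.fract Y), h⟩

variable {s m : ℝ}

theorem mem_rect_iff {p : ℝ × ℝ} :
    p ∈ Rect s ↔ (1 - s ≤ p.1 ∧ p.1 ≤ 1) ∧ 0 ≤ p.2 ∧ p.2 ≤ 1 := Iff.rfl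

theorem isPt_proj (p : ℝ × ℝ) (h : p ∈ Rect s) : IsPt s p.1 p.2 (proj s ⟨p, h⟩) := by
  obtain ⟨x, y⟩ := p
  rcases h.2.2.eq_or_lt with h1 | h1
  · have hy : y = 1 := h1
    subst hy
    have h0 : ((x, Int.fract 1) : ℝ × ℝ) ∈ Rect s := ⟨h.1, by simp⟩
    exact ⟨h0, (Quot.sound (Glue.horizontal ⟨_, h0⟩ ⟨_, h⟩ rfl (by simp) rfl)).symm⟩
  · have : Int.fract y = y := Int.fract_eq_self.2 ⟨h.2.1, h1⟩
    unfold IsPt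
    simp only [this]
    exact ⟨h, trivial⟩

theorem IsPt.congr {x Y Y' : ℝ} {q : XPlus s} (h : IsPt s x Y q)
    (hY : Int.fract Y = Int.fract Y') : IsPt s x Y' q := by
  unfold IsPt at h ⊢
  rwa [← hY]

open Classical in
/-- Coordinates of the points in the interior of the rectangle or on the edge `B`. -/
noncomputable def coord (s : ℝ) : XPlus s → ℝ × ℝ :=
  -- On the vertical sides the value is a dummy whose abscissa 2 lies outside the rectangle, so it
  -- never coincides with genuine coordinates.
  Quot.lift (fun p : Rect s => if p.1.1 ∈ Ioo (1 - s) 1 then (p.1.1, Int.fract p.1.2) else (2, 0))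
    (by
      intro p q h
      cases h with
      | horizontal hx hp hq => simp [hx, hp, hq]
      | vertical hp hq hy => simp [hp, hq])

theorem IsPt.inj {x Y x' Y' : ℝ} {q : XPlus s} (h : IsPt s x Y q) (h' : IsPt s x' Y' q)
    (hx : x ∈ Ioo (1 - s) 1) : x' = x ∧ Int.fract Y' = Int.fract Y := by
  obtain ⟨h1, rfl⟩ := h
  obtain ⟨h2, h3⟩ := h'
  have h4 := congrArg (coord s) h3
  simp only [coord, proj, if_pos hx, Int.fract_fract] at h4
  split_ifs at h4 with h5
  · rw [Prod.mk.injEq] at h4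
    exact ⟨h4.1.symm, h4.2.symm⟩
  · rw [Prod.mk.injEq] at h4
    linarith [hx.2, h4.1]

/-- The points of the rectangle that represent a point of the edge `A`. -/
def RepA (s : ℝ) (p : ℝ × ℝ) : Prop :=
  p.1 = 1 ∨ p.1 = 1 - s ∧ (p.2 ≤ s ∨ p.2 = 1)

/-- The points of the rectangle that represent a point of the edge `B`. -/
def RepB (s : ℝ) (p : ℝ × ℝ) : Prop :=
  p.2 = 0 ∨ p.2 = 1 ∨ p = (1 - s, s)

/-- The predicate respects each gluing and so descends to the quotient; membership in the edge can
then be tested on any representative. The point `(1 - s, 1)` belongs to it because it is glued to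
`(1 - s, 0)`. -/
theorem repA_congr (hs0 : 0 < s) {p q : Rect s} (h : proj s p = proj s q) :
    RepA s p.1 ↔ RepA s q.1 := by
  have : ∀ p q : Rect s, Glue s p q → (RepA s p.1) = (RepA s q.1) := by
    intro p q h
    apply propext
    cases h with
    | horizontal hx hp hq =>
      simp only [RepA, hx, hp, hq]
      simp [hs0.le]
    | vertical hp hq hy =>
      simp only [RepA, hp, hq, hy, true_or, true_iff]
      refine Or.inr ⟨trivial, Or.inl ?_⟩
      nlinarith [p.2.2.2]
  exact iff_of_eq (congrArg (Quot.lift (fun p : Rect s => RepA s p.1) this) h)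

/-- As for `A`; here the exceptional point `(1 - s, s)` is glued to the corner `(1, 1)`. -/
theorem repB_congr (hs0 : 0 < s) (hs1 : s < 1) {p q : Rect s} (h : proj s p = proj s q) :
    RepB s p.1 ↔ RepB s q.1 := by
  have : ∀ p q : Rect s, Glue s p q → (RepB s p.1) = (RepB s q.1) := by
    intro p q h
    apply propext
    cases h with
    | horizontal hx hp hq =>
      simp [RepB, hp, hq]
    | vertical hp hq hy =>
      have h1 := p.2.2.2
      have h2 := p.2.2.1
      have hne : p.1 ≠ (1 - s, s) := fun h => by
        rw [h] at hp
        simp only at hp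
        linarith
      have hq' : q.1 = (1 - s, s * p.1.2) := Prod.ext hq hy
      simp only [RepB, hne, or_false, hq', Prod.mk.injEq, true_and, mul_eq_zero, hs0.ne', false_or]
      have h3 : s * p.1.2 = s ↔ p.1.2 = 1 := by
        constructor
        · intro h
          exact mul_left_cancel₀ hs0.ne' (by rw [h, mul_one])
        · intro h
          rw [h, mul_one]
      have h4 : s * p.1.2 ≠ 1 := by nlinarith
      simp [h3, h4]
  exact iff_of_eq (congrArg (Quot.lift (fun p : Rect s => RepB s p.1) this) h)

theorem IsPt.mem_edge_A (hs0 : 0 < s) {x Y : ℝ} {q : XPlus s} (h : IsPt s x Y q)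
    (hx : 1 - s < x) : q ∈ edge s Letter.A ↔ x = 1 := by
  obtain ⟨h1, rfl⟩ := h
  constructor
  · rintro ⟨p, hp, he⟩
    rcases (repA_congr hs0 he).1 (Or.inl hp) with h | h
    · exact h
    · exact absurd h.1 hx.ne'
  · intro h
    exact ⟨_, h, rfl⟩

theorem IsPt.mem_edge_B (hs0 : 0 < s) (hs1 : s < 1) {x Y : ℝ} {q : XPlus s} (h : IsPt s x Y q)
    (hx : 1 - s < x) : q ∈ edge s Letter.B ↔ ∃ N : ℤ, Y = N := by
  obtain ⟨h1, rfl⟩ := h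
  constructor
  · rintro ⟨p, hp, he⟩
    rcases (repB_congr hs0 hs1 he).1 (Or.inr (Or.inl hp)) with h | h | h
    · exact ⟨⌊Y⌋, by
        have : Int.fract Y = 0 := h
        rw [Int.fract] at this
        linarith⟩
    · exact absurd h (Int.fract_lt_one Y).ne
    · exact absurd (congrArg Prod.fst h) hx.ne'
  · rintro ⟨N, rfl⟩
    have h2 : ((x, 1) : ℝ × ℝ) ∈ Rect s := ⟨h1.1, by simp⟩
    exact ⟨⟨_, h2⟩, rfl, (Quot.sound (Glue.horizontal ⟨_, h1⟩ ⟨_, h2⟩ rfl (by simp) rfl)).symm⟩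

/-! ### A trajectory between two visits to the edge `A` -/

variable {τ : ℝ → XPlus s}

theorem StartsAlong.isPt {t : ℝ} {p : ℝ × ℝ} {v : ℝ} (h : StartsAlong s m τ t p v) :
    0 < v ∧ ∃ ε > 0, ∀ u : ℝ, 0 ≤ u → u < ε →
      IsPt s (p.1 + u * v) (p.2 + u * v * m) (τ (t + u)) := by
  obtain ⟨hv, ε, hε, h⟩ := h
  refine ⟨hv, ε, hε, fun u h0 h1 => ?_⟩
  obtain ⟨h2, h3⟩ := h u h0 h1
  rw [h3]
  simpa using isPt_proj _ h2

theorem StartsAlong.mem {t : ℝ} {p : ℝ × ℝ} {v : ℝ} (h : StartsAlong s m τ t p v) :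
    p ∈ Rect s ∧ p.1 < 1 ∧ (0 < m → p.2 < 1) ∧ (m < 0 → 0 < p.2) := by
  obtain ⟨hv, ε, hε, h⟩ := h
  obtain ⟨h2, -⟩ := h 0 le_rfl hε
  obtain ⟨h3, -⟩ := h (ε / 2) (by positivity) (by linarith)
  simp only [mem_rect_iff, Prod.fst_add, Prod.snd_add, Prod.smul_fst, Prod.smul_snd,
    smul_eq_mul, mul_one] at h3
  have h4 : 0 < ε / 2 * v := by positivity
  refine ⟨by simpa using h2, by linarith [h3.1.2], fun hm => ?_, fun hm => ?_⟩
  · have := mul_pos h4 hm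
    linarith [h3.2.2]
  · have := mul_neg_of_pos_of_neg h4 hm
    linarith [h3.2.1]

theorem ArrivesAlong.isPt {t : ℝ} {p : ℝ × ℝ} {v : ℝ} (h : ArrivesAlong s m τ t p v) :
    0 < v ∧ ∃ ε > 0, ∀ u : ℝ, 0 ≤ u → u < ε →
      IsPt s (p.1 - u * v) (p.2 - u * v * m) (τ (t - u)) := by
  obtain ⟨hv, ε, hε, h⟩ := h
  refine ⟨hv, ε, hε, fun u h0 h1 => ?_⟩
  obtain ⟨h2, h3⟩ := h u h0 h1
  rw [h3]
  simpa using isPt_proj _ h2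

/-- Just before the time `t + u` the curve lies in the open strip, where coordinates are unique, so
the outgoing and the incoming description can be compared. -/
theorem arrives_of_segment {t u v : ℝ} {p q : ℝ × ℝ} {v₁ : ℝ} (hp : 1 - s ≤ p.1) (hv : 0 < v)
    (hu : 0 < u) (huU : p.1 + u * v ≤ 1)
    (hgood : ∀ w, 0 ≤ w → w < u → IsPt s (p.1 + w * v) (p.2 + w * v * m) (τ (t + w)))
    (harr : ArrivesAlong s m τ (t + u) q v₁) :
    v₁ = v ∧ q.1 = p.1 + u * v ∧ Int.fract q.2 = Int.fract (p.2 + u * v * m) := by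
  obtain ⟨-, ε, hε, h⟩ := harr.isPt
  have key : ∀ w, 0 < w → w < ε → w < u → q.1 - w * v₁ = p.1 + (u - w) * v ∧
      Int.fract (q.2 - w * v₁ * m) = Int.fract (p.2 + (u - w) * v * m) := by
    intro w h0 h1 h2
    have h3 := h w h0.le h1
    rw [show t + u - w = t + (u - w) by ring] at h3
    refine (hgood (u - w) (by linarith) (by linarith)).inj h3 ⟨?_, ?_⟩
    · have := mul_pos (sub_pos.2 h2) hv
      linarith
    · have := mul_pos h0 hv
      nlinarith
  have hδ : 0 < min ε u := lt_min hε hu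
  have h1 := min_le_left ε u
  have h2 := min_le_right ε u
  -- Two sample times suffice to identify the two affine abscissas, hence both the speeds and the
  -- end points.
  obtain ⟨a1, b1⟩ := key (min ε u / 2) (by positivity) (by linarith) (by linarith)
  obtain ⟨a2, -⟩ := key (min ε u / 4) (by positivity) (by linarith) (by linarith)
  have hvv : v₁ = v := by
    have : min ε u * (v₁ - v) = 0 := by linarith
    rcases mul_eq_zero.1 this with h | h
    · exact absurd h hδ.ne'
    · linarith
  subst hvv
  refine ⟨rfl, by linarith, ?_⟩
  obtain ⟨z, hz⟩ := Int.fract_eq_fract.1 b1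
  exact Int.fract_eq_fract.2 ⟨z, by rw [← hz]; ring⟩

/-- A continuation argument: at the supremum of the times up to which the curve follows the line,
the local description at that time prolongs the line unless the right edge has been reached. -/
theorem segment_of_startsAlong (hτ : ∀ t : ℝ, 0 < t → ∃ q v p v',
      ArrivesAlong s m τ t q v ∧ Continues s q v p v' ∧ StartsAlong s m τ t p v')
    {t v : ℝ} {p : ℝ × ℝ} (ht : 0 ≤ t) (hst : StartsAlong s m τ t p v) :
    ∀ u, 0 ≤ u → u < (1 - p.1) / v →
      IsPt s (p.1 + u * v) (p.2 + u * v * m) (τ (t + u)) := by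
  obtain ⟨hv, ε, hε, hgood⟩ := hst.isPt
  obtain ⟨hpr, hp1, -⟩ := hst.mem
  set U := (1 - p.1) / v with hUdef
  have hU : 0 < U := div_pos (by linarith) hv
  have hUv : U * v = 1 - p.1 := div_mul_cancel₀ _ hv.ne'
  let G : Set ℝ := {u | u ≤ U ∧ ∀ w, 0 ≤ w → w < u →
    IsPt s (p.1 + w * v) (p.2 + w * v * m) (τ (t + w))}
  have hGb : BddAbove G := ⟨U, fun u hu => hu.1⟩
  have hG0 : min ε U ∈ G := ⟨min_le_right _ _, fun w h0 h1 =>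
    hgood w h0 (h1.trans_le (min_le_left _ _))⟩
  have hstar : sSup G ∈ G := by
    refine ⟨csSup_le ⟨_, hG0⟩ fun u hu => hu.1, fun w h0 h1 => ?_⟩
    obtain ⟨u, hu, hwu⟩ := exists_lt_of_lt_csSup ⟨_, hG0⟩ h1
    exact hu.2 w h0 hwu
  have hpos : 0 < sSup G := (lt_min hε hU).trans_le (le_csSup hGb hG0)
  suffices h : sSup G = U by
    rw [← h]
    exact hstar.2
  by_contra hne
  have hlt : sSup G < U := hstar.1.lt_of_ne hne
  have hlt' : p.1 + sSup G * v < 1 := by nlinarith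
  obtain ⟨q, v₁, p', v', harr, hcont, hst'⟩ := hτ (t + sSup G) (by linarith)
  obtain ⟨rfl, hq1, hq2⟩ := arrives_of_segment hpr.1.1 hv hpos hlt'.le hstar.2 harr
  -- Before abscissa 1 only the trivial continuation or a crossing of `B` is possible, and both
  -- preserve the height mod 1.
  have hp' : p'.1 = q.1 ∧ Int.fract p'.2 = Int.fract q.2 ∧ v' = v₁ := by
    obtain ⟨-, ⟨rfl, h⟩ | ⟨h, -, -⟩ | ⟨h, rfl, h'⟩ | ⟨h, rfl, h'⟩⟩ := hcont
    · exact ⟨rfl, rfl, h⟩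
    · linarith
    · exact ⟨rfl, by simp [h], h'⟩
    · exact ⟨rfl, by simp [h], h'⟩
  obtain ⟨h1, h2, rfl⟩ := hp'
  obtain ⟨-, δ, hδ, hgood'⟩ := hst'.isPt
  have : min (sSup G + δ) U ∈ G := by
    refine ⟨min_le_right _ _, fun w h0 hw => ?_⟩
    rcases lt_or_ge w (sSup G) with h | h
    · exact hstar.2 w h0 h
    · have h3 := hgood' (w - sSup G) (by linarith)
        (by linarith [hw.trans_le (min_le_left (sSup G + δ) U)])
      rw [h1, hq1, show t + sSup G + (w - sSup G) = t + w by ring,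
        show p.1 + sSup G * v' + (w - sSup G) * v' = p.1 + w * v' by ring] at h3
      refine h3.congr ?_
      obtain ⟨z, hz⟩ := Int.fract_eq_fract.1 (h2.trans hq2)
      exact Int.fract_eq_fract.2 ⟨z, by rw [← hz]; ring⟩
  have := le_csSup hGb this
  rcases min_le_iff.1 this with h | h <;> linarith

/-- A forward trajectory that leaves `p` runs straight to the right edge, which it meets at a
nonsingular point, and continues from the corresponding point of the left edge. -/
theorem leg_of_startsAlong (hτ : ∀ t : ℝ, 0 < t → ∃ q v p v',
      ArrivesAlong s m τ t q v ∧ Continues s q v p v' ∧ StartsAlong s m τ t p v')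
    {t v : ℝ} {p : ℝ × ℝ} (ht : 0 ≤ t) (hst : StartsAlong s m τ t p v) :
    NonInt (p.2 + (1 - p.1) * m) ∧
    (∀ u, 0 ≤ u → u ≤ (1 - p.1) / v →
      IsPt s (p.1 + u * v) (p.2 + u * v * m) (τ (t + u))) ∧
    StartsAlong s m τ (t + (1 - p.1) / v) (1 - s, s * Int.fract (p.2 + (1 - p.1) * m)) (s * v) := by
  have hseg := segment_of_startsAlong hτ ht hst
  obtain ⟨hv, -⟩ := hst.isPt
  obtain ⟨hpr, hp1, -⟩ := hst.mem
  set U := (1 - p.1) / v with hUdef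
  have hU : 0 < U := div_pos (by linarith) hv
  have hUv : U * v = 1 - p.1 := div_mul_cancel₀ _ hv.ne'
  obtain ⟨q, v₁, p', v', harr, hcont, hst'⟩ := hτ (t + U) (by linarith)
  obtain ⟨rfl, hq1, hq2⟩ := arrives_of_segment hpr.1.1 hv hU (by linarith) hseg harr
  rw [hUv] at hq1 hq2
  have hq1' : q.1 = 1 := by linarith
  have hp'1 := hst'.mem.2.1
  obtain ⟨hvert, hcont⟩ := hcont
  obtain ⟨-, ε', hε', h0⟩ := harr.isPt
  have hqr := harr.2
  obtain ⟨ε'', hε'', hqr⟩ := hqr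
  obtain ⟨hqr, -⟩ := hqr 0 le_rfl hε''
  simp only [zero_mul, zero_smul, sub_zero] at hqr
  -- The corners are singular, so the arrival is at a height strictly between 0 and 1.
  have hq2lt : q.2 < 1 := hqr.2.2.lt_of_ne fun h => hvert (Or.inl ⟨Or.inr hq1', Or.inr h⟩)
  have hq2pos : 0 < q.2 := hqr.2.1.lt_of_ne fun h => hvert (Or.inl ⟨Or.inr hq1', Or.inl h.symm⟩)
  have hfr : Int.fract q.2 = q.2 := Int.fract_eq_self.2 ⟨hq2pos.le, hq2lt⟩
  refine ⟨fun N hN => ?_, fun u hu hle => ?_, ?_⟩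
  · rw [hN, Int.fract_intCast, hfr] at hq2
    exact hq2pos.ne' hq2
  · rcases hle.eq_or_lt with rfl | hlt
    · have h1 := h0 0 le_rfl hε'
      simp only [zero_mul, sub_zero] at h1
      rw [hUv, ← hq1]
      exact h1.congr hq2
    · exact hseg u hu hlt
  · rw [← hq2, hfr]
    -- All continuations except the one through `A` would leave from abscissa 1, where no motion to
    -- the right is possible.
    rcases hcont with ⟨rfl, -⟩ | ⟨-, rfl, rfl⟩ | ⟨-, rfl, -⟩ | ⟨-, rfl, -⟩
    · linarith
    · exact hst'
    · simp only at hp'1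
      linarith
    · simp only at hp'1
      linarith

/-! ### The legs of a trajectory -/

/-- The numbers of events of the legs: `e` for the first, the variation of `N` for the others. -/
def counts (e : ℕ) (N : ℕ → ℤ) : ℕ → ℕ
  | 0 => e
  | k + 1 => (N (k + 1) - N k).natAbs

theorem exists_mem_leg {T : ℕ → ℝ} (h0 : T 0 = 0) (htop : Tendsto T atTop atTop)
    (u : ℝ) (hu : 0 < u) : ∃ k, u ∈ Ioc (T k) (T (k + 1)) := by
  classical
  have hex : ∃ k, u ≤ T k := (htop.eventually_ge_atTop u).exists
  have hk := Nat.find_spec hex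
  have hk0 : Nat.find hex ≠ 0 := fun h => by
    rw [h, h0] at hk
    linarith
  obtain ⟨k, hk'⟩ := Nat.exists_eq_succ_of_ne_zero hk0
  refine ⟨k, not_le.1 (Nat.find_min hex (by omega)), ?_⟩
  rwa [hk'] at hk

/-- The lift of the first return map to the right edge. -/
noncomputable def returnLift (s m L : ℝ) : ℝ := (1 - s) * ⌊L⌋ + s * L + s * m

/-- In this form the integer part records the level already reached, and the bracket is the arrival
height of a line that re-enters at `s * fract L` and crosses the width `s` with slope `m`. -/
theorem returnLift_eq (s m L : ℝ) :
    returnLift s m L = ⌊L⌋ + (s * Int.fract L + s * m) := by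
  rw [returnLift, Int.fract]; ring

/-- The passage from one visit to the right edge to the next is iterated. Arrival heights agree mod
1 with the orbit of `returnLift`, and a leg that starts at a height in `(0, 1)` crosses as many
levels as the integer part of the lift changes. -/
theorem exists_legs (hs0 : 0 < s) (hs1 : s < 1) (hτ : IsForwardTrajectory s m τ) :
    ∃ x₀ y₀ : ℝ, (1 - s ≤ x₀ ∧ x₀ < 1) ∧ (0 ≤ y₀ ∧ y₀ ≤ 1) ∧ (0 < m → y₀ < 1) ∧ (m < 0 → 0 < y₀) ∧
      (∀ k, NonInt ((returnLift s m)^[k] (y₀ + (1 - x₀) * m))) ∧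
      ∃ T, Legs (fun u L => τ u ∈ edge s L) T
        (counts (cnt y₀ (y₀ + (1 - x₀) * m))
          (fun k => ⌊(returnLift s m)^[k] (y₀ + (1 - x₀) * m)⌋)) := by
  obtain ⟨⟨p₀, v, hst⟩, hτ⟩ := hτ
  obtain ⟨hpr, hp1, hpm, hpm'⟩ := hst.mem
  have hv := hst.1
  obtain ⟨p, hp0, hp_succ⟩ : ∃ p : ℕ → ℝ × ℝ, p 0 = p₀ ∧
      ∀ k, p (k + 1) = (1 - s, s * Int.fract ((p k).2 + (1 - (p k).1) * m)) :=
    ⟨fun k => Nat.rec p₀ (fun _ p => (1 - s, s * Int.fract (p.2 + (1 - p.1) * m))) k, rfl,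
      fun _ => rfl⟩
  obtain ⟨T, hT0, hT_succ⟩ : ∃ T : ℕ → ℝ, T 0 = 0 ∧
      ∀ k, T (k + 1) = T k + (1 - (p k).1) / (s ^ k * v) :=
    ⟨fun k => Nat.rec 0 (fun k T => T + (1 - (p k).1) / (s ^ k * v)) k, rfl, fun _ => rfl⟩
  have hstart : ∀ k, 0 ≤ T k ∧ StartsAlong s m τ (T k) (p k) (s ^ k * v) := by
    intro k
    induction k with
    | zero => exact ⟨hT0.ge, by simpa [hT0, hp0] using hst⟩
    | succ k ih =>
      refine ⟨?_, ?_⟩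
      · rw [hT_succ]
        have := ih.2.mem.2.1
        have h2 : 0 < (1 - (p k).1) / (s ^ k * v) := div_pos (by linarith) ih.2.1
        linarith [ih.1]
      · rw [hT_succ, hp_succ, pow_succ', mul_assoc]
        exact (leg_of_startsAlong hτ ih.1 ih.2).2.2
  have hleg := fun k => leg_of_startsAlong hτ (hstart k).1 (hstart k).2
  have hlt1 : ∀ k, (p k).1 < 1 := fun k => (hstart k).2.mem.2.1
  have hge : ∀ k, 1 - s ≤ (p k).1 := fun k => (hstart k).2.mem.1.1.1
  have hvk : ∀ k, 0 < s ^ k * v := fun k => (hstart k).2.1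
  have hTlt : ∀ k, T k < T (k + 1) := fun k => by
    rw [hT_succ]
    have : 0 < (1 - (p k).1) / (s ^ k * v) := div_pos (by linarith [hlt1 k]) (hvk k)
    linarith
  -- A leg after the first has width `s` and horizontal speed at most `v`, so it lasts at least `s /
  -- v`. Thus the legs exhaust all positive times.
  have hTgrow : ∀ k : ℕ, (k : ℝ) * (s / v) ≤ T (k + 1) := by
    intro k
    induction k with
    | zero => simpa using (hstart 1).1
    | succ k ih =>
      rw [hT_succ]
      have h1 : s / v ≤ (1 - (p (k + 1)).1) / (s ^ (k + 1) * v) := by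
        rw [hp_succ]
        simp only [sub_sub_cancel]
        apply div_le_div_of_nonneg_left hs0.le (hvk _)
        have : s ^ (k + 1) ≤ 1 := pow_le_one₀ hs0.le hs1.le
        nlinarith
      push_cast
      linarith
  have hTtop : Tendsto T atTop atTop := by
    rw [← tendsto_add_atTop_iff_nat 1]
    exact tendsto_atTop_mono hTgrow
      (tendsto_natCast_atTop_atTop.atTop_mul_const (div_pos hs0 hv))
  -- positions along the leg `k`
  have hpos : ∀ k, ∀ u ∈ Ioc (T k) (T (k + 1)),
      IsPt s ((p k).1 + (u - T k) * (s ^ k * v)) ((p k).2 + (u - T k) * ((s ^ k * v) * m)) (τ u) ∧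
      1 - s < (p k).1 + (u - T k) * (s ^ k * v) := by
    intro k u hu
    have h1 := (hleg k).2.1 (u - T k) (by linarith [hu.1])
      (by have := hu.2; rw [hT_succ] at this; linarith)
    rw [add_sub_cancel, mul_assoc _ (s ^ k * v)] at h1
    refine ⟨h1, ?_⟩
    have := mul_pos (sub_pos.2 hu.1) (hvk k)
    linarith [hge k]
  have hend : ∀ k, (T (k + 1) - T k) * (s ^ k * v) = 1 - (p k).1 := fun k => by
    rw [hT_succ, add_sub_cancel_left, div_mul_cancel₀ _ (hvk k).ne']
  have hset : ∀ k, {u ∈ Ioo (T k) (T (k + 1)) | τ u ∈ edge s Letter.B} =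
      {u ∈ Ioo (T k) (T (k + 1)) | ∃ N : ℤ, (p k).2 + (u - T k) * ((s ^ k * v) * m) = N} := by
    intro k
    ext u
    refine and_congr_right fun hu => ?_
    obtain ⟨h1, h2⟩ := hpos k u ⟨hu.1, hu.2.le⟩
    exact h1.mem_edge_B hs0 hs1 h2
  have hYend : ∀ k, (p k).2 + (T (k + 1) - T k) * ((s ^ k * v) * m) =
      (p k).2 + (1 - (p k).1) * m := fun k => by rw [← mul_assoc, hend]
  have hnon : ∀ k, NonInt ((p k).2 + (1 - (p k).1) * m) := fun k => (hleg k).1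
  have hlev := fun k => affine_levels (hTlt k) (H := (p k).2) (σ := (s ^ k * v) * m)
    (by rw [hYend]; exact hnon k)
  set Λ : ℕ → ℝ := fun k => (returnLift s m)^[k] (p₀.2 + (1 - p₀.1) * m) with hΛ
  have hΛs : ∀ k, Λ (k + 1) = returnLift s m (Λ k) := fun k => Function.iterate_succ_apply' _ _ _
  have hY_succ : ∀ k, (p (k + 1)).2 + (1 - (p (k + 1)).1) * m =
      s * Int.fract ((p k).2 + (1 - (p k).1) * m) + s * m := fun k => by
    rw [hp_succ]
    simp only
    ring
  have hΛf : ∀ k, Int.fract (Λ k) = Int.fract ((p k).2 + (1 - (p k).1) * m) := by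
    intro k
    induction k with
    | zero => rw [hp0]; rfl
    | succ k ih => rw [hΛs, hY_succ, ← ih, returnLift_eq, Int.fract_intCast_add]
  have hΛn : ∀ k, NonInt (Λ k) := fun k N hN => by
    have h1 := hΛf k
    rw [hN, Int.fract_intCast] at h1
    exact hnon k ⌊(p k).2 + (1 - (p k).1) * m⌋ (by rw [Int.fract] at h1; linarith)
  refine ⟨p₀.1, p₀.2, ⟨hpr.1.1, hp1⟩, hpr.2, hpm, hpm', hΛn, T, hT0,
    strictMono_nat_of_lt_succ hTlt, exists_mem_leg hT0 hTtop, fun k L => ?_, fun k u hu => ?_,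
    fun k => ?_, fun k => ?_⟩
  · obtain ⟨h1, h2⟩ := hpos k (T (k + 1)) ⟨hTlt k, le_rfl⟩
    cases L
    · rw [h1.mem_edge_A hs0 h2, hend]
      simp
    · rw [h1.mem_edge_B hs0 hs1 h2, hYend]
      simp only [reduceCtorEq, iff_false]
      rintro ⟨N, hN⟩
      exact hnon k N hN
  · obtain ⟨h1, h2⟩ := hpos k u ⟨hu.1, hu.2.le⟩
    rw [h1.mem_edge_A hs0 h2]
    have := mul_lt_mul_of_pos_right (sub_lt_sub_right hu.2 (T k)) (hvk k)
    rw [hend] at this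
    linarith
  · rw [hset]
    exact (hlev k).1
  · rw [hset, (hlev k).2, hYend]
    cases k with
    | zero => rw [hp0]; rfl
    | succ k =>
      have hfpos : 0 < Int.fract (Λ k) :=
        (Int.fract_nonneg _).lt_of_ne fun h => hΛn k ⌊Λ k⌋ (by rw [Int.fract] at h; linarith)
      have hflt := Int.fract_lt_one (Λ k)
      have hH : (p (k + 1)).2 = s * Int.fract (Λ k) := by rw [hp_succ, hΛf]
      have hHpos : 0 < s * Int.fract (Λ k) := mul_pos hs0 hfpos
      have hHlt : s * Int.fract (Λ k) < 1 := by nlinarith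
      have hHfl : ⌊s * Int.fract (Λ k)⌋ = 0 := Int.floor_eq_zero_iff.2 ⟨hHpos.le, hHlt⟩
      have hHn : NonInt (s * Int.fract (Λ k)) := fun N hN => by
        rw [hN, Int.floor_intCast] at hHfl
        rw [hN, hHfl] at hHpos
        simp at hHpos
      rw [cnt_eq_natAbs (hH ▸ hHn) (hnon (k + 1)), hY_succ, hH, hHfl, ← hΛf]
      change _ = (⌊Λ (k + 1)⌋ - ⌊Λ k⌋).natAbs
      rw [hΛs, returnLift_eq, Int.floor_intCast_add]
      congr 1
      ring

/-! ### Geometrically weighted sums of integers -/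

section weighted

variable {s : ℝ}

theorem summable_weighted (hs0 : 0 < s) (hs1 : s < 1) (C : ℝ) :
    Summable fun j : ℕ => s ^ (j + 1) * (C * ((j : ℝ) + 1)) := by
  have h1 := summable_pow_mul_geometric_of_norm_lt_one 1
    (show ‖s‖ < 1 by rwa [Real.norm_of_nonneg hs0.le])
  have h2 := (summable_nat_add_iff 1).2 h1
  refine (h2.mul_left C).congr fun j => ?_
  push_cast
  ring

theorem summable_of_le (hs0 : 0 < s) (hs1 : s < 1) {C : ℝ} {a : ℕ → ℝ}
    (ha : ∀ j : ℕ, |a j| ≤ C * ((j : ℝ) + 1)) : Summable fun j : ℕ => s ^ (j + 1) * a j := by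
  refine Summable.of_norm_bounded (summable_weighted hs0 hs1 C) fun j => ?_
  rw [norm_mul, Real.norm_of_nonneg (by positivity), Real.norm_eq_abs]
  exact mul_le_mul_of_nonneg_left (ha j) (by positivity)

/-- Dominated convergence; each integer coefficient is eventually equal to its limit. -/
theorem tendsto_weighted (hs0 : 0 < s) (hs1 : s < 1) {l : Filter ℝ} {C : ℝ} {a : ℝ → ℕ → ℤ}
    {b : ℕ → ℤ} (ha : ∀ᶠ x in l, ∀ j : ℕ, |(a x j : ℝ)| ≤ C * ((j : ℝ) + 1))
    (hab : ∀ j, ∀ᶠ x in l, a x j = b j) :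
    Tendsto (fun x => ∑' j : ℕ, s ^ (j + 1) * (a x j : ℝ)) l
      (𝓝 (∑' j : ℕ, s ^ (j + 1) * (b j : ℝ))) := by
  refine tendsto_tsum_of_dominated_convergence (summable_weighted hs0 hs1 C) (fun j => ?_) ?_
  · refine tendsto_const_nhds.congr' ?_
    filter_upwards [hab j] with x hx
    rw [hx]
  · filter_upwards [ha] with x hx j
    rw [norm_mul, Real.norm_of_nonneg (by positivity), Real.norm_eq_abs]
    exact mul_le_mul_of_nonneg_left (hx j) (by positivity)

theorem tsum_weighted_one (hs0 : 0 < s) (hs1 : s < 1) :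
    ∑' j : ℕ, s ^ (j + 1) = s / (1 - s) := by
  simp_rw [pow_succ]
  rw [tsum_mul_right, tsum_geometric_of_lt_one hs0.le hs1]
  field_simp

theorem abs_ceil_le (y : ℝ) : |(⌈y⌉ : ℝ)| ≤ |y| + 1 := by
  have h1 := Int.le_ceil y
  have h2 := Int.ceil_lt_add_one y
  rw [abs_le]
  constructor
  · linarith [neg_abs_le y]
  · linarith [le_abs_self y]

theorem abs_floor_le (y : ℝ) : |(⌊y⌋ : ℝ)| ≤ |y| + 1 := by
  have h1 := Int.floor_le y
  have h2 := Int.lt_floor_add_one y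
  rw [abs_le]
  constructor
  · linarith [neg_abs_le y]
  · linarith [le_abs_self y]

theorem abs_mul_add_one_le {x D : ℝ} (hx : |x| ≤ D) (j : ℕ) :
    |((j + 1 : ℕ) : ℝ) * x| + 1 ≤ (D + 1) * ((j : ℝ) + 1) := by
  rw [abs_mul, Nat.abs_cast]
  push_cast
  have : (0 : ℝ) ≤ j := Nat.cast_nonneg j
  nlinarith

theorem summable_ceil (hs0 : 0 < s) (hs1 : s < 1) (x : ℝ) :
    Summable fun j : ℕ => s ^ (j + 1) * (⌈((j + 1 : ℕ) : ℝ) * x⌉ : ℝ) :=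
  summable_of_le hs0 hs1 fun j => (abs_ceil_le _).trans (abs_mul_add_one_le le_rfl j)

theorem summable_floor (hs0 : 0 < s) (hs1 : s < 1) (x : ℝ) :
    Summable fun j : ℕ => s ^ (j + 1) * (⌊((j + 1 : ℕ) : ℝ) * x⌋ : ℝ) :=
  summable_of_le hs0 hs1 fun j => (abs_floor_le _).trans (abs_mul_add_one_le le_rfl j)

theorem summable_one (hs0 : 0 < s) (hs1 : s < 1) : Summable fun j : ℕ => s ^ (j + 1) := by
  simp_rw [pow_succ]
  exact (summable_geometric_of_lt_one hs0.le hs1).mul_right s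

/-! ### The functions `Δ_s^±` -/

/-- The constant `(1 - s) / s` equals `((1 - s) / s)² ∑ s^j`. Absorbing it turns `⌊j x⌋` into `⌊j x⌋
+ 1`, which is comparable with `⌈j x⌉` term by term. -/
theorem deltaPlus_eq (hs0 : 0 < s) (hs1 : s < 1) (x : ℝ) :
    deltaPlus s x = ((1 - s) / s) ^ 2 *
      ∑' j : ℕ, s ^ (j + 1) * ((⌊((j + 1 : ℕ) : ℝ) * x⌋ + 1 : ℤ) : ℝ) := by
  have h : ∀ j : ℕ, s ^ (j + 1) * ((⌊((j + 1 : ℕ) : ℝ) * x⌋ + 1 : ℤ) : ℝ) =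
      s ^ (j + 1) * (⌊((j + 1 : ℕ) : ℝ) * x⌋ : ℝ) + s ^ (j + 1) := fun j => by push_cast; ring
  simp_rw [h]
  rw [(summable_floor hs0 hs1 x).tsum_add (summable_one hs0 hs1), tsum_weighted_one hs0 hs1,
    deltaPlus]
  have : 1 - s ≠ 0 := by linarith
  generalize ∑' j : ℕ, s ^ (j + 1) * (⌊((j + 1 : ℕ) : ℝ) * x⌋ : ℝ) = X
  field_simp
  ring

theorem summable_floor_add_one (hs0 : 0 < s) (hs1 : s < 1) (x : ℝ) :
    Summable fun j : ℕ => s ^ (j + 1) * ((⌊((j + 1 : ℕ) : ℝ) * x⌋ + 1 : ℤ) : ℝ) := by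
  refine ((summable_floor hs0 hs1 x).add (summable_one hs0 hs1)).congr fun j => ?_
  push_cast
  ring

theorem deltaMinus_le_deltaPlus (hs0 : 0 < s) (hs1 : s < 1) (x : ℝ) :
    deltaMinus s x ≤ deltaPlus s x := by
  rw [deltaPlus_eq hs0 hs1, deltaMinus]
  refine mul_le_mul_of_nonneg_left ?_ (by positivity)
  refine (summable_ceil hs0 hs1 x).tsum_le_tsum (fun j => ?_) (summable_floor_add_one hs0 hs1 x)
  exact mul_le_mul_of_nonneg_left (by exact_mod_cast Int.ceil_le_floor_add_one _) (by positivity)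

/-- For `x < y` one has `⌊j x⌋ + 1 ≤ ⌈j y⌉` for every `j ≥ 1`. Thus the intervals `[Δ⁻(x), Δ⁺(x)]`
do not overlap except possibly at end points. -/
theorem deltaPlus_le_deltaMinus (hs0 : 0 < s) (hs1 : s < 1) {x y : ℝ} (h : x < y) :
    deltaPlus s x ≤ deltaMinus s y := by
  rw [deltaPlus_eq hs0 hs1, deltaMinus]
  refine mul_le_mul_of_nonneg_left ?_ (by positivity)
  refine (summable_floor_add_one hs0 hs1 x).tsum_le_tsum (fun j => ?_) (summable_ceil hs0 hs1 y)
  refine mul_le_mul_of_nonneg_left ?_ (by positivity)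
  have h1 : (⌊((j + 1 : ℕ) : ℝ) * x⌋ : ℝ) < ((j + 1 : ℕ) : ℝ) * y :=
    (Int.floor_le _).trans_lt (mul_lt_mul_of_pos_left h (by positivity))
  exact_mod_cast Int.add_one_le_iff.2 (Int.lt_ceil.2 h1)

theorem deltaMinus_mono (hs0 : 0 < s) (hs1 : s < 1) : Monotone (deltaMinus s) := by
  intro x y h
  rcases h.eq_or_lt with rfl | h
  · exact le_rfl
  · exact (deltaMinus_le_deltaPlus hs0 hs1 x).trans (deltaPlus_le_deltaMinus hs0 hs1 h)

theorem deltaPlus_mono (hs0 : 0 < s) (hs1 : s < 1) : Monotone (deltaPlus s) := by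
  intro x y h
  rcases h.eq_or_lt with rfl | h
  · exact le_rfl
  · exact (deltaPlus_le_deltaMinus hs0 hs1 h).trans (deltaMinus_le_deltaPlus hs0 hs1 y)

theorem deltaMinus_zero (s : ℝ) : deltaMinus s 0 = 0 := by
  simp [deltaMinus]

theorem deltaPlus_zero (s : ℝ) : deltaPlus s 0 = (1 - s) / s := by
  simp [deltaPlus]

theorem NonInt.of_irrational {x : ℝ} (h : Irrational x) : NonInt x := fun N hN => h ⟨N, by simp [hN]⟩

theorem nonInt_succ_mul {ξ : ℝ} (h : Irrational ξ) (j : ℕ) : NonInt (((j + 1 : ℕ) : ℝ) * ξ) :=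
  NonInt.of_irrational (h.natCast_mul (Nat.succ_ne_zero j))

theorem deltaMinus_eq_deltaPlus (hs0 : 0 < s) (hs1 : s < 1) {ξ : ℝ} (h : Irrational ξ) :
    deltaMinus s ξ = deltaPlus s ξ := by
  rw [deltaPlus_eq hs0 hs1, deltaMinus]
  congr 1
  refine tsum_congr fun j => ?_
  rw [(nonInt_succ_mul h j).ceil_eq]

/-! ### One-sided limits of `Δ_s⁻` and the rotation number of a slope -/

theorem tendsto_deltaMinus_left (hs0 : 0 < s) (hs1 : s < 1) (ρ : ℝ) :
    Tendsto (deltaMinus s) (𝓝[<] ρ) (𝓝 (deltaMinus s ρ)) := by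
  refine (tendsto_weighted hs0 hs1 (C := |ρ| + 1 + 1) ?_ fun j => ?_).const_mul _
  · filter_upwards [Ioo_mem_nhdsLT (show ρ - 1 < ρ by linarith)] with x hx j
    refine (abs_ceil_le _).trans (abs_mul_add_one_le ?_ j)
    rw [abs_le]
    constructor
    · linarith [neg_abs_le ρ, hx.1]
    · linarith [le_abs_self ρ, hx.2]
  · have hj : (0 : ℝ) < ((j + 1 : ℕ) : ℝ) := by positivity
    have h1 : ((⌈((j + 1 : ℕ) : ℝ) * ρ⌉ : ℝ) - 1) / ((j + 1 : ℕ) : ℝ) < ρ := by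
      rw [div_lt_iff₀ hj]
      linarith [Int.ceil_lt_add_one (((j + 1 : ℕ) : ℝ) * ρ)]
    filter_upwards [Ioo_mem_nhdsLT h1] with x hx
    rw [Int.ceil_eq_iff]
    have h2 := (div_lt_iff₀ hj).1 hx.1
    have h3 := mul_lt_mul_of_pos_left hx.2 hj
    exact ⟨by linarith, h3.le.trans (Int.le_ceil _)⟩

theorem tendsto_deltaMinus_right (hs0 : 0 < s) (hs1 : s < 1) (ρ : ℝ) :
    Tendsto (deltaMinus s) (𝓝[>] ρ) (𝓝 (deltaPlus s ρ)) := by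
  rw [deltaPlus_eq hs0 hs1]
  refine (tendsto_weighted hs0 hs1 (C := |ρ| + 1 + 1) ?_ fun j => ?_).const_mul _
  · filter_upwards [Ioo_mem_nhdsGT (show ρ < ρ + 1 by linarith)] with x hx j
    refine (abs_ceil_le _).trans (abs_mul_add_one_le ?_ j)
    rw [abs_le]
    constructor
    · linarith [neg_abs_le ρ, hx.1]
    · linarith [le_abs_self ρ, hx.2]
  · have hj : (0 : ℝ) < ((j + 1 : ℕ) : ℝ) := by positivity
    have h1 : ρ < ((⌊((j + 1 : ℕ) : ℝ) * ρ⌋ : ℝ) + 1) / ((j + 1 : ℕ) : ℝ) := by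
      rw [lt_div_iff₀ hj]
      linarith [Int.lt_floor_add_one (((j + 1 : ℕ) : ℝ) * ρ)]
    filter_upwards [Ioo_mem_nhdsGT h1] with x hx
    rw [Int.ceil_eq_iff]
    have h2 := (lt_div_iff₀ hj).1 hx.2
    have h3 := mul_lt_mul_of_pos_left hx.1 hj
    push_cast at *
    exact ⟨by linarith [Int.floor_le (((j : ℝ) + 1) * ρ)], by linarith⟩

/-- Linearity on the integers shows that `Δ_s⁻` is unbounded in both directions. -/
theorem deltaMinus_intCast (s : ℝ) (N : ℤ) : deltaMinus s N =
    N * (((1 - s) / s) ^ 2 * ∑' j : ℕ, s ^ (j + 1) * (1 * ((j : ℝ) + 1))) := by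
  rw [deltaMinus, mul_left_comm, ← tsum_mul_left (a := (N : ℝ))]
  refine congrArg _ (tsum_congr fun j => ?_)
  have : ((j + 1 : ℕ) : ℝ) * (N : ℝ) = (((j + 1 : ℕ) * N : ℤ) : ℝ) := by push_cast; ring
  rw [this, Int.ceil_intCast]
  push_cast
  ring

/-- Every slope lies between the values of `Δ_s⁻` and `Δ_s⁺` at some point. -/
theorem exists_rotation (hs0 : 0 < s) (hs1 : s < 1) (m : ℝ) :
    ∃ ρ, deltaMinus s ρ ≤ m ∧ m ≤ deltaPlus s ρ := by
  set K := ((1 - s) / s) ^ 2 * ∑' j : ℕ, s ^ (j + 1) * (1 * ((j : ℝ) + 1)) with hK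
  have hKpos : 0 < K := by
    have : 0 < (1 - s) / s := div_pos (by linarith) hs0
    refine mul_pos (by positivity) ?_
    exact (summable_weighted hs0 hs1 1).tsum_pos (fun j => by positivity) 0 (by simpa using hs0)
  let S : Set ℝ := {x | deltaMinus s x ≤ m}
  have hne : S.Nonempty := by
    refine ⟨(⌊m / K⌋ : ℤ), ?_⟩
    change deltaMinus s _ ≤ m
    rw [deltaMinus_intCast, ← hK, ← le_div_iff₀ hKpos]
    exact Int.floor_le _
  have hbdd : BddAbove S := by
    refine ⟨((⌊m / K⌋ + 1 : ℤ) : ℝ), fun x hx => not_lt.1 fun h => ?_⟩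
    have h1 := (deltaMinus_mono hs0 hs1 h.le).trans hx
    rw [deltaMinus_intCast, ← hK, ← le_div_iff₀ hKpos] at h1
    push_cast at h1
    linarith [Int.lt_floor_add_one (m / K)]
  -- At the supremum of the points with `Δ⁻ ≤ m`, the left limit of `Δ⁻` is `Δ⁻` and its right limit
  -- is `Δ⁺`.
  refine ⟨sSup S, le_of_tendsto (tendsto_deltaMinus_left hs0 hs1 _) ?_,
    ge_of_tendsto (tendsto_deltaMinus_right hs0 hs1 _) ?_⟩
  · filter_upwards [self_mem_nhdsWithin] with x hx
    obtain ⟨y, hy, hxy⟩ := exists_lt_of_lt_csSup hne hx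
    exact (deltaMinus_mono hs0 hs1 hxy.le).trans hy
  · filter_upwards [self_mem_nhdsWithin] with x hx
    exact (not_le.1 fun h => absurd (le_csSup hbdd h) (not_le.2 hx)).le

/-- A slope in the closure of the values that is not a value at a rational point is a value at
irrational points only. -/
theorem irrational_of_mem_slopesC (hs0 : 0 < s) (hs1 : s < 1) {m ρ : ℝ}
    (hm : m ∈ slopesC s \ slopesC' s) (h1 : deltaMinus s ρ ≤ m) (h2 : m ≤ deltaPlus s ρ) :
    Irrational ρ := by
  rintro ⟨r, rfl⟩
  have hlt1 : deltaMinus s r < m := h1.lt_of_ne fun h => hm.2 ⟨r, Or.inl h.symm⟩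
  have hlt2 : m < deltaPlus s r := h2.lt_of_ne fun h => hm.2 ⟨r, Or.inr h⟩
  -- By monotonicity the open gap between `Δ⁻(r)` and `Δ⁺(r)` contains no value of either function,
  -- so it misses the closure.
  obtain ⟨y, ⟨hy1, hy2⟩, hy⟩ := mem_closure_iff.1 hm.1 (Ioo (deltaMinus s r) (deltaPlus s r))
    isOpen_Ioo ⟨hlt1, hlt2⟩
  rcases hy with ⟨x, rfl⟩ | ⟨x, rfl⟩
  · rcases le_or_gt x r with h | h
    · exact absurd (deltaMinus_mono hs0 hs1 h) (not_le.2 hy1)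
    · exact absurd (deltaPlus_le_deltaMinus hs0 hs1 h) (not_le.2 hy2)
  · rcases lt_or_ge x r with h | h
    · exact absurd (deltaPlus_le_deltaMinus hs0 hs1 h) (not_le.2 hy1)
    · exact absurd (deltaPlus_mono hs0 hs1 h) (not_le.2 hy2)

/-- At an irrational `ρ` the interval degenerates to a point of the image, which a slope in `U_s`
cannot be. -/
theorem exists_rational_rotation (hs0 : 0 < s) (hs1 : s < 1) {m : ℝ}
    (hm : m ∈ slopesU s ∪ slopesC' s) :
    ∃ r : ℚ, deltaMinus s r ≤ m ∧ m ≤ deltaPlus s r := by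
  rcases hm with hm | ⟨r, rfl | rfl⟩
  · obtain ⟨ρ, h1, h2⟩ := exists_rotation hs0 hs1 m
    by_cases h : Irrational ρ
    · rw [← deltaMinus_eq_deltaPlus hs0 hs1 h] at h2
      exact absurd (subset_closure (mem_union_left _ (mem_range.2 ⟨ρ, h1.antisymm h2⟩))) hm
    · obtain ⟨r, rfl⟩ := not_not.1 h
      exact ⟨r, h1, h2⟩
  · exact ⟨r, le_rfl, deltaMinus_le_deltaPlus hs0 hs1 _⟩
  · exact ⟨r, deltaMinus_le_deltaPlus hs0 hs1 _, le_rfl⟩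

end weighted

/-! ### The semiconjugacy with the rotation -/

/-- The map that conjugates the translation by `ρ` to the lift of the first return map. -/
noncomputable def phi (s m ρ z : ℝ) : ℝ :=
  s * m / (1 - s) +
    (1 - s) / s * ∑' j : ℕ, s ^ (j + 1) * (⌊z - ((j + 1 : ℕ) : ℝ) * ρ⌋ : ℝ)

section phi

variable {s m ρ : ℝ}

theorem abs_floor_sub_le (ρ z : ℝ) (j : ℕ) :
    |(⌊z - ((j + 1 : ℕ) : ℝ) * ρ⌋ : ℝ)| ≤ (|z| + |ρ| + 1) * ((j : ℝ) + 1) := by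
  refine (abs_floor_le _).trans ?_
  have h1 := abs_sub z (((j + 1 : ℕ) : ℝ) * ρ)
  have h2 := abs_mul_add_one_le (le_refl |ρ|) j
  have h3 : |z| ≤ |z| * ((j : ℝ) + 1) :=
    le_mul_of_one_le_right (abs_nonneg z) (by linarith [(Nat.cast_nonneg j : (0 : ℝ) ≤ j)])
  linarith

theorem summable_phi (hs0 : 0 < s) (hs1 : s < 1) (ρ z : ℝ) :
    Summable fun j : ℕ => s ^ (j + 1) * (⌊z - ((j + 1 : ℕ) : ℝ) * ρ⌋ : ℝ) :=
  summable_of_le hs0 hs1 (abs_floor_sub_le ρ z)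

theorem phi_mono (hs0 : 0 < s) (hs1 : s < 1) : Monotone (phi s m ρ) := by
  intro x y h
  refine add_le_add_right (mul_le_mul_of_nonneg_left ?_ (div_pos (by linarith) hs0).le) _
  refine (summable_phi hs0 hs1 ρ x).tsum_le_tsum (fun j => ?_) (summable_phi hs0 hs1 ρ y)
  refine mul_le_mul_of_nonneg_left ?_ (by positivity)
  exact_mod_cast Int.floor_le_floor (by linarith)

theorem phi_add_intCast (hs0 : 0 < s) (hs1 : s < 1) (z : ℝ) (N : ℤ) :
    phi s m ρ (z + N) = phi s m ρ z + N := by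
  have h : ∀ j : ℕ, s ^ (j + 1) * (⌊z + N - ((j + 1 : ℕ) : ℝ) * ρ⌋ : ℝ) =
      s ^ (j + 1) * (⌊z - ((j + 1 : ℕ) : ℝ) * ρ⌋ : ℝ) + s ^ (j + 1) * N := fun j => by
    rw [show z + N - ((j + 1 : ℕ) : ℝ) * ρ = z - ((j + 1 : ℕ) : ℝ) * ρ + N by ring,
      Int.floor_add_intCast]
    push_cast
    ring
  unfold phi
  simp_rw [h]
  rw [(summable_phi hs0 hs1 ρ z).tsum_add ((summable_one hs0 hs1).mul_right _), tsum_mul_right,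
    tsum_weighted_one hs0 hs1]
  have : 1 - s ≠ 0 := by linarith
  generalize ∑' j : ℕ, s ^ (j + 1) * (⌊z - ((j + 1 : ℕ) : ℝ) * ρ⌋ : ℝ) = X
  field_simp
  ring

/-- This is where `Δ⁻` comes from: `Δ⁻(ρ) ≤ m` says that `0 ≤ phi 0`. Likewise `m ≤ Δ⁺(ρ)` gives
`phi ≤ 1` to the left of 1. -/
theorem phi_zero (hs0 : 0 < s) (hs1 : s < 1) :
    phi s m ρ 0 = s / (1 - s) * (m - deltaMinus s ρ) := by
  have h : ∀ j : ℕ, s ^ (j + 1) * (⌊0 - ((j + 1 : ℕ) : ℝ) * ρ⌋ : ℝ) =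
      -(s ^ (j + 1) * (⌈((j + 1 : ℕ) : ℝ) * ρ⌉ : ℝ)) := fun j => by
    rw [zero_sub, Int.floor_neg]
    push_cast
    ring
  unfold phi deltaMinus
  simp_rw [h]
  rw [tsum_neg]
  have : 1 - s ≠ 0 := by linarith
  generalize ∑' j : ℕ, s ^ (j + 1) * (⌈((j + 1 : ℕ) : ℝ) * ρ⌉ : ℝ) = X
  field_simp
  ring

theorem phi_le_one (hs0 : 0 < s) (hs1 : s < 1) (h : m ≤ deltaPlus s ρ) {z : ℝ} (hz : z < 1) :
    phi s m ρ z ≤ 1 := by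
  have hs : 0 < 1 - s := by linarith
  have h1 : ∑' j : ℕ, s ^ (j + 1) * (⌊z - ((j + 1 : ℕ) : ℝ) * ρ⌋ : ℝ) ≤
      -∑' j : ℕ, s ^ (j + 1) * (⌊((j + 1 : ℕ) : ℝ) * ρ⌋ : ℝ) := by
    rw [← tsum_neg]
    refine (summable_phi hs0 hs1 ρ z).tsum_le_tsum (fun j => ?_) (summable_floor hs0 hs1 ρ).neg
    rw [← mul_neg]
    refine mul_le_mul_of_nonneg_left ?_ (by positivity)
    have : ⌊z - ((j + 1 : ℕ) : ℝ) * ρ⌋ < -⌊((j + 1 : ℕ) : ℝ) * ρ⌋ + 1 := by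
      rw [Int.floor_lt]
      push_cast
      have := Int.floor_le (((j : ℝ) + 1) * ρ)
      linarith
    exact_mod_cast Int.lt_add_one_iff.1 this
  have h2 : phi s m ρ z ≤ 1 + s / (1 - s) * (m - deltaPlus s ρ) := by
    refine (add_le_add_right (mul_le_mul_of_nonneg_left h1 (div_pos hs hs0).le) _).trans
      (le_of_eq ?_)
    unfold deltaPlus
    generalize ∑' j : ℕ, s ^ (j + 1) * (⌊((j + 1 : ℕ) : ℝ) * ρ⌋ : ℝ) = X
    field_simp
    ring
  have h3 : s / (1 - s) * (m - deltaPlus s ρ) ≤ 0 :=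
    mul_nonpos_of_nonneg_of_nonpos (div_pos hs0 hs).le (by linarith)
  linarith

theorem floor_le_phi (hs0 : 0 < s) (hs1 : s < 1) (h : deltaMinus s ρ ≤ m) (z : ℝ) :
    (⌊z⌋ : ℝ) ≤ phi s m ρ z := by
  have h1 := phi_mono (m := m) (ρ := ρ) hs0 hs1 (Int.floor_le z)
  rw [← zero_add (⌊z⌋ : ℝ), phi_add_intCast hs0 hs1, phi_zero hs0 hs1] at h1
  have : 0 ≤ s / (1 - s) * (m - deltaMinus s ρ) :=
    mul_nonneg (div_pos hs0 (by linarith)).le (by linarith)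
  linarith

theorem phi_le_floor_add_one (hs0 : 0 < s) (hs1 : s < 1) (h : m ≤ deltaPlus s ρ) (z : ℝ) :
    phi s m ρ z ≤ ⌊z⌋ + 1 := by
  have h1 := phi_le_one hs0 hs1 h (Int.fract_lt_one z)
  have h2 := phi_add_intCast (m := m) (ρ := ρ) hs0 hs1 (Int.fract z) ⌊z⌋
  rw [Int.fract_add_floor] at h2
  linarith

/-- Translation by `ρ` shifts the series by one index, and the new first term contributes `(1 -
s)⌊z⌋`. Where `⌊phi z⌋ = ⌊z⌋`, the right side is `returnLift (phi z)`. -/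
theorem phi_add_self (hs0 : 0 < s) (hs1 : s < 1) (z : ℝ) :
    phi s m ρ (z + ρ) = (1 - s) * ⌊z⌋ + s * phi s m ρ z + s * m := by
  have h1 := (summable_phi hs0 hs1 ρ (z + ρ)).tsum_eq_zero_add
  have h2 : ∀ j : ℕ, s ^ (j + 1 + 1) * (⌊z + ρ - ((j + 1 + 1 : ℕ) : ℝ) * ρ⌋ : ℝ) =
      s * (s ^ (j + 1) * (⌊z - ((j + 1 : ℕ) : ℝ) * ρ⌋ : ℝ)) := fun j => by
    rw [show z + ρ - ((j + 1 + 1 : ℕ) : ℝ) * ρ = z - ((j + 1 : ℕ) : ℝ) * ρ by push_cast; ring]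
    ring
  simp_rw [h2] at h1
  rw [tsum_mul_left] at h1
  simp only [zero_add, pow_one, Nat.cast_one, one_mul, add_sub_cancel_right] at h1
  unfold phi
  rw [h1]
  have : 1 - s ≠ 0 := by linarith
  generalize ∑' j : ℕ, s ^ (j + 1) * (⌊z - ((j + 1 : ℕ) : ℝ) * ρ⌋ : ℝ) = X
  field_simp
  ring

/-- The terms of `phi` jump only at points `N + j ρ` with `N` an integer and `j ≥ 1`; for irrational
`ρ` none of these is 0. -/
theorem tendsto_phi_zero (hs0 : 0 < s) (hs1 : s < 1) (hρ : Irrational ρ) :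
    Tendsto (phi s m ρ) (𝓝 0) (𝓝 (phi s m ρ 0)) := by
  refine ((tendsto_weighted hs0 hs1 (C := 1 + |ρ| + 1) ?_ fun j => ?_).const_mul _).const_add _
  · filter_upwards [Ioo_mem_nhds (show (-1 : ℝ) < 0 by norm_num) one_pos] with z hz j
    refine (abs_floor_sub_le ρ z j).trans ?_
    have : |z| ≤ 1 := abs_le.2 ⟨hz.1.le, hz.2.le⟩
    gcongr
  · have hn : NonInt (0 - ((j + 1 : ℕ) : ℝ) * ρ) := fun N hN =>
      nonInt_succ_mul hρ j (-N) (by push_cast at hN ⊢; linarith)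
    set y := 0 - ((j + 1 : ℕ) : ℝ) * ρ with hy
    filter_upwards [Ioo_mem_nhds (show (⌊y⌋ : ℝ) - y < 0 by linarith [hn.floor_lt])
      (show 0 < (⌊y⌋ : ℝ) + 1 - y by linarith [Int.lt_floor_add_one y])] with z hz
    rw [Int.floor_eq_iff]
    constructor <;> linarith [hz.1, hz.2]

/-! ### Shadowing orbits of the return map by orbits of the translation -/

theorem returnLift_mono (hs0 : 0 < s) (hs1 : s < 1) : Monotone (returnLift s m) := by
  intro x y h
  unfold returnLift
  have h1 : (⌊x⌋ : ℝ) ≤ ⌊y⌋ := by exact_mod_cast Int.floor_le_floor h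
  have h2 := mul_le_mul_of_nonneg_left h1 (show 0 ≤ 1 - s by linarith)
  have h3 := mul_le_mul_of_nonneg_left h hs0.le
  linarith

/-- An orbit of the return map that avoids the integers shadows an orbit of the translation. -/
theorem exists_phase (hs0 : 0 < s) (hs1 : s < 1) (h1 : deltaMinus s ρ ≤ m)
    (h2 : m ≤ deltaPlus s ρ) {x : ℝ} (hx : ∀ k, NonInt ((returnLift s m)^[k] x)) :
    ∃ z₀, ∀ k : ℕ, (∀ z < z₀ + k * ρ, phi s m ρ z ≤ (returnLift s m)^[k] x) ∧
      (∀ z > z₀ + k * ρ, (returnLift s m)^[k] x ≤ phi s m ρ z) := by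
  -- The phase is a generalized inverse of `phi` at `x`: `phi` may jump over `x` or be constant near
  -- it.
  let S : Set ℝ := {z | phi s m ρ z ≤ x}
  have hne : S.Nonempty := ⟨x - 1, (phi_le_floor_add_one hs0 hs1 h2 _).trans
    (by linarith [Int.floor_le (x - 1)])⟩
  have hbdd : BddAbove S := ⟨x + 1, fun z hz => by
    have := (floor_le_phi hs0 hs1 h1 z).trans hz
    linarith [Int.lt_floor_add_one z]⟩
  refine ⟨sSup S, fun k => ?_⟩
  induction k with
  | zero =>
    refine ⟨fun z hz => ?_, fun z hz => ?_⟩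
    · simp only [Nat.cast_zero, zero_mul, add_zero] at hz
      obtain ⟨y, hy, hzy⟩ := exists_lt_of_lt_csSup hne hz
      exact (phi_mono hs0 hs1 hzy.le).trans hy
    · simp only [Nat.cast_zero, zero_mul, add_zero] at hz
      exact (not_le.1 fun h => absurd (le_csSup hbdd h) (not_le.2 hz)).le
  | succ k ih =>
    rw [Function.iterate_succ_apply']
    set L := (returnLift s m)^[k] x with hL
    have hLn : NonInt L := hx k
    have key : ∀ z, phi s m ρ z = (1 - s) * ⌊z - ρ⌋ + s * phi s m ρ (z - ρ) + s * m := fun z => by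
      rw [← phi_add_self hs0 hs1, sub_add_cancel]
    refine ⟨fun z hz => ?_, fun z hz => ?_⟩
    · have h3 := ih.1 (z - ρ) (by push_cast at hz; linarith)
      have h4 : (⌊z - ρ⌋ : ℝ) ≤ ⌊L⌋ := by
        exact_mod_cast Int.le_floor.2 ((floor_le_phi hs0 hs1 h1 _).trans h3)
      rw [key, returnLift]
      have := mul_le_mul_of_nonneg_left h4 (show 0 ≤ 1 - s by linarith)
      have := mul_le_mul_of_nonneg_left h3 hs0.le
      linarith
    · have h3 := ih.2 (z - ρ) (by push_cast at hz; linarith)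
      -- The bound `L ≤ ⌊z - ρ⌋ + 1` controls the integer part of `L` only because `L` is not an
      -- integer.
      have h4 : (⌊L⌋ : ℝ) ≤ ⌊z - ρ⌋ := by
        have h5 := h3.trans (phi_le_floor_add_one hs0 hs1 h2 _)
        have h6 : L < ⌊z - ρ⌋ + 1 := h5.lt_of_ne (by exact_mod_cast hLn (⌊z - ρ⌋ + 1))
        have h7 : ⌊L⌋ < ⌊z - ρ⌋ + 1 := Int.floor_lt.2 (by exact_mod_cast h6)
        exact_mod_cast Int.lt_add_one_iff.1 h7
      rw [key, returnLift]
      have := mul_le_mul_of_nonneg_left h4 (show 0 ≤ 1 - s by linarith)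
      have := mul_le_mul_of_nonneg_left h3 hs0.le
      linarith

section shadow

variable (hs0 : 0 < s) (hs1 : s < 1) (h1 : deltaMinus s ρ ≤ m) (h2 : m ≤ deltaPlus s ρ)
  {L y : ℝ} (hL : NonInt L) (hlow : ∀ z < y, phi s m ρ z ≤ L) (hup : ∀ z > y, L ≤ phi s m ρ z)
include hs0 hs1 h1 h2 hL hlow hup

/-- Points on both sides of `y` within the same unit interval enclose `L` in `[⌊y⌋, ⌊y⌋ + 1]`, and
the upper end is excluded. -/
theorem floor_eq_of_shadow (hy : NonInt y) : ⌊L⌋ = ⌊y⌋ := by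
  have ha := (floor_le_phi hs0 hs1 h1 _).trans (hlow ⌊y⌋ hy.floor_lt)
  rw [Int.floor_intCast] at ha
  have hlt := Int.lt_floor_add_one y
  have hb := (hup ((y + (⌊y⌋ + 1)) / 2) (by linarith)).trans (phi_le_floor_add_one hs0 hs1 h2 _)
  have hfl : ⌊(y + (⌊y⌋ + 1)) / 2⌋ = ⌊y⌋ := by
    rw [Int.floor_eq_iff]
    constructor <;> linarith [Int.floor_le y]
  rw [hfl] at hb
  rw [Int.floor_eq_iff]
  exact ⟨ha, hb.lt_of_ne (by exact_mod_cast hL (⌊y⌋ + 1))⟩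

/-- At an integer phase the points on the two sides lie in adjacent unit intervals, which leaves two
possible integer parts. -/
theorem floor_mem_of_shadow {M : ℤ} (hy : y = M) : M - 1 ≤ ⌊L⌋ ∧ ⌊L⌋ ≤ M := by
  subst hy
  have ha := (floor_le_phi hs0 hs1 h1 _).trans (hlow ((M - 1 : ℤ) : ℝ) (by push_cast; linarith))
  rw [Int.floor_intCast] at ha
  have hb := (hup (M + 1 / 2) (by linarith)).trans (phi_le_floor_add_one hs0 hs1 h2 _)
  have hfl : ⌊(M : ℝ) + 1 / 2⌋ = M := by
    rw [Int.floor_eq_iff]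
    constructor <;> linarith
  rw [hfl] at hb
  refine ⟨Int.le_floor.2 ha, Int.lt_add_one_iff.1 (Int.floor_lt.2 ?_)⟩
  push_cast
  exact hb.lt_of_ne (by exact_mod_cast hL (M + 1))

/-- For irrational `ρ` the function `phi` is continuous at every integer `M` with value `M`, so a
phase equal to `M` would force `L = M`. -/
theorem nonInt_of_shadow (hρ : Irrational ρ) : NonInt y := by
  rintro M rfl
  have h0 : phi s m ρ 0 = 0 := by
    have : m = deltaMinus s ρ := le_antisymm (deltaMinus_eq_deltaPlus hs0 hs1 hρ ▸ h2) h1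
    rw [phi_zero hs0 hs1, ← this, sub_self, mul_zero]
  have ht := tendsto_phi_zero (m := m) hs0 hs1 hρ
  rw [h0] at ht
  apply hL M
  apply le_antisymm
  · have : L - M ≤ 0 := by
      refine ge_of_tendsto (ht.mono_left (nhdsWithin_le_nhds (s := Ioi 0))) ?_
      filter_upwards [self_mem_nhdsWithin] with z hz
      have := hup (z + M) (by linarith [mem_Ioi.1 hz])
      rw [phi_add_intCast hs0 hs1] at this
      linarith
    linarith
  · have : 0 ≤ L - M := by
      refine le_of_tendsto (ht.mono_left (nhdsWithin_le_nhds (s := Iio 0))) ?_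
      filter_upwards [self_mem_nhdsWithin] with z hz
      have := hlow (z + M) (by linarith [mem_Iio.1 hz])
      rw [phi_add_intCast hs0 hs1] at this
      linarith
    linarith

end shadow

end phi

/-! ### The rational case: eventual behaviour of the integer parts -/

section rational

variable {s m : ℝ}

theorem returnLift_add_intCast (x : ℝ) (N : ℤ) :
    returnLift s m (x + N) = returnLift s m x + N := by
  unfold returnLift
  rw [Int.floor_add_intCast]
  push_cast
  ring

theorem iterate_returnLift_add_intCast (n : ℕ) (x : ℝ) (N : ℤ) :
    (returnLift s m)^[n] (x + N) = (returnLift s m)^[n] x + N := by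
  induction n with
  | zero => rfl
  | succ n ih =>
    rw [Function.iterate_succ_apply', Function.iterate_succ_apply', ih, returnLift_add_intCast]

/-- A monotone or antitone sequence with values in `{M - 1, M}` is eventually constant. -/
theorem eventually_const_of_two_values {f : ℕ → ℤ} {M : ℤ} (hf : Monotone f ∨ Antitone f)
    (h : ∀ i, M - 1 ≤ f i ∧ f i ≤ M) :
    ∃ b : ℤ, (b = 0 ∨ b = -1) ∧ ∃ I, ∀ i ≥ I, f i = M + b := by
  rcases hf with hf | hf
  · by_cases hex : ∃ I, f I = M
    · obtain ⟨I, hI⟩ := hex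
      exact ⟨0, Or.inl rfl, I, fun i hi => by have := hf hi; have := h i; omega⟩
    · push Not at hex
      exact ⟨-1, Or.inr rfl, 0, fun i _ => by have := hex i; have := h i; omega⟩
  · by_cases hex : ∃ I, f I = M - 1
    · obtain ⟨I, hI⟩ := hex
      exact ⟨-1, Or.inr rfl, I, fun i hi => by have := hf hi; have := h i; omega⟩
    · push Not at hex
      exact ⟨0, Or.inl rfl, 0, fun i _ => by have := hex i; have := h i; omega⟩

/-- The offset `(1 + 2 * b) / 2` is `1/2` for `b = 0` and `-1/2` for `b = -1`: half a step of the
lattice of multiples of `1/q`, upwards or downwards. -/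
theorem nonInt_half {x q b : ℤ} (hq : 0 < q) (hb : b = 0 ∨ b = -1) :
    NonInt (((x : ℝ) + (1 + 2 * b) / 2) / q) := by
  intro N hN
  rw [div_eq_iff (by exact_mod_cast hq.ne')] at hN
  have h1 : (2 * x + (1 + 2 * b) : ℝ) = 2 * (N * q) := by rw [← hN]; ring
  have h2 : 2 * x + (1 + 2 * b) = 2 * (N * q) := by exact_mod_cast h1
  rcases hb with rfl | rfl <;> omega

theorem floor_half {x q b : ℤ} (hq : 0 < q) (hb : b = 0 ∨ b = -1) (hx : ¬ q ∣ x) :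
    ⌊((x : ℝ) + (1 + 2 * b) / 2) / q⌋ = ⌊(x : ℝ) / q⌋ := by
  have hq' : (0 : ℝ) < q := by exact_mod_cast hq
  set n := ⌊(x : ℝ) / q⌋ with hn
  have h1 : (n : ℝ) * q ≤ x := (le_div_iff₀ hq').1 (Int.floor_le _)
  have h2 : (x : ℝ) < (n + 1) * q := (div_lt_iff₀ hq').1 (Int.lt_floor_add_one _)
  have h1' : n * q ≤ x := by exact_mod_cast h1
  have h2' : x < (n + 1) * q := by exact_mod_cast h2
  have h3 : n * q ≠ x := fun h => hx ⟨n, by rw [← h, mul_comm]⟩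
  have h4 : n * q + 1 ≤ x := by omega
  have h5 : x + 1 ≤ (n + 1) * q := by omega
  have h4' : (n : ℝ) * q + 1 ≤ x := by exact_mod_cast h4
  have h5' : (x : ℝ) + 1 ≤ (n + 1) * q := by exact_mod_cast h5
  rw [Int.floor_eq_iff, le_div_iff₀ hq', div_lt_iff₀ hq']
  rcases hb with rfl | rfl
  · push_cast
    constructor <;> linarith
  · push_cast
    constructor <;> linarith

/-- If the phase meets an integer, it does so again every `r.den` steps. Along these times the
orbit, reduced by `r.num` per period, is the orbit of a monotone map and hence monotone, so the
choice between the two possible integer parts stabilizes. Half a lattice step in the direction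
chosen breaks all ties consistently and alters no other integer part. -/
theorem exists_eventually_floor_eq (hs0 : 0 < s) (hs1 : s < 1) {r : ℚ}
    (h1 : deltaMinus s r ≤ m) (h2 : m ≤ deltaPlus s r) {x : ℝ}
    (hx : ∀ k, NonInt ((returnLift s m)^[k] x)) :
    ∃ z : ℝ, (∀ k : ℕ, NonInt (z + k * r)) ∧
      ∃ K : ℕ, ∀ k ≥ K, ⌊(returnLift s m)^[k] x⌋ = ⌊z + k * r⌋ := by
  obtain ⟨y, hy⟩ := exists_phase hs0 hs1 h1 h2 hx
  have hfl : ∀ k : ℕ, NonInt (y + k * r) → ⌊(returnLift s m)^[k] x⌋ = ⌊y + k * r⌋ := fun k =>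
    floor_eq_of_shadow hs0 hs1 h1 h2 (hx k) (hy k).1 (hy k).2
  by_cases hall : ∀ k : ℕ, NonInt (y + k * r)
  · exact ⟨y, hall, 0, fun k _ => hfl k (hall k)⟩
  unfold NonInt at hall
  push Not at hall
  obtain ⟨k₀, M, hM⟩ := hall
  have hq : (0 : ℤ) < r.den := by exact_mod_cast r.den_pos
  have hq' : (0 : ℝ) < r.den := by exact_mod_cast r.den_pos
  have hqe : ((r.den : ℤ) : ℝ) = r.den := by push_cast; rfl
  have hr : (r : ℝ) = r.num / r.den := Rat.cast_def r
  set L : ℕ → ℝ := fun k => (returnLift s m)^[k] x with hL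
  have hLadd : ∀ n k, L (n + k) = (returnLift s m)^[n] (L k) := fun n k =>
    Function.iterate_add_apply _ _ _ _
  -- the times at which the shadow is an integer
  have hint : ∀ i : ℕ, y + ((k₀ + i * r.den : ℕ) : ℝ) * r = ((M + i * r.num : ℤ) : ℝ) := fun i => by
    push_cast
    rw [← hM, add_mul, hr]
    field_simp
    ring
  let G : ℝ → ℝ := fun w => (returnLift s m)^[r.den] w - r.num
  have hG : Monotone G := fun a b hab =>
    sub_le_sub_right ((returnLift_mono hs0 hs1).iterate r.den hab) _
  have hR : ∀ i : ℕ, L (k₀ + i * r.den) - (i * r.num : ℤ) = G^[i] (L k₀) := by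
    intro i
    induction i with
    | zero => simp
    | succ i ih =>
      rw [Function.iterate_succ_apply', ← ih]
      change _ = (returnLift s m)^[r.den] _ - _
      rw [show L (k₀ + i * r.den) - ((i * r.num : ℤ) : ℝ) =
          L (k₀ + i * r.den) + ((-(i * r.num) : ℤ) : ℝ) by push_cast; ring,
        iterate_returnLift_add_intCast, ← hLadd, show k₀ + (i + 1) * r.den = r.den + (k₀ + i * r.den) by ring]
      push_cast
      ring
  have hmon : Monotone (fun i : ℕ => ⌊L (k₀ + i * r.den)⌋ - i * r.num) ∨
      Antitone (fun i : ℕ => ⌊L (k₀ + i * r.den)⌋ - i * r.num) := by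
    have heq : ∀ i : ℕ, ⌊L (k₀ + i * r.den)⌋ - i * r.num = ⌊G^[i] (L k₀)⌋ := fun i => by
      rw [← hR, Int.floor_sub_intCast]
    simp_rw [heq]
    rcases le_total (L k₀) (G (L k₀)) with h | h
    · exact Or.inl fun i j hij => Int.floor_le_floor (hG.monotone_iterate_of_le_map h hij)
    · exact Or.inr fun i j hij => Int.floor_le_floor (hG.antitone_iterate_of_map_le h hij)
  obtain ⟨b, hb, I, hI⟩ := eventually_const_of_two_values (M := M) hmon fun i => by
    have := floor_mem_of_shadow hs0 hs1 h1 h2 (hx (k₀ + i * r.den)) (hy _).1 (hy _).2 (hint i)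
    simp only [hL]
    constructor <;> linarith [this.1, this.2]
  set a : ℤ := M * r.den - k₀ * r.num with ha
  have hya : ∀ k : ℕ, y + k * r = ((a + k * r.num : ℤ) : ℝ) / ((r.den : ℤ) : ℝ) := fun k => by
    have : y = M - k₀ * r := by linarith
    rw [this, hqe, hr, ha]
    push_cast
    field_simp
  have hz : ∀ k : ℕ, y + (1 + 2 * b) / 2 / r.den + k * r =
      (((a + k * r.num : ℤ) : ℝ) + (1 + 2 * b) / 2) / ((r.den : ℤ) : ℝ) := fun k => by
    rw [add_right_comm, hya, hqe, ← add_div]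
  refine ⟨y + (1 + 2 * b) / 2 / r.den, fun k => ?_, k₀ + I * r.den, fun k hk => ?_⟩
  · rw [hz]
    exact nonInt_half hq hb
  rw [hz]
  by_cases hdvd : (r.den : ℤ) ∣ a + k * r.num
  · obtain ⟨j, rfl⟩ := Nat.exists_eq_add_of_le (show k₀ ≤ k by nlinarith)
    have h3 : (r.den : ℤ) ∣ j * r.num := by
      have : a + ((k₀ + j : ℕ) : ℤ) * r.num = M * r.den + j * r.num := by
        rw [ha]; push_cast; ring
      rw [this] at hdvd
      exact (dvd_add_right (Dvd.intro_left M rfl)).1 hdvd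
    have hcop : IsCoprime (r.den : ℤ) r.num :=
      (Int.isCoprime_iff_gcd_eq_one.2 (by simpa [Int.gcd] using r.reduced)).symm
    have h4 : r.den ∣ j := by exact_mod_cast hcop.dvd_of_dvd_mul_right h3
    obtain ⟨i, rfl⟩ := h4
    rw [mul_comm r.den i] at hk ⊢
    have hiI : I ≤ i := by
      have : I * r.den ≤ i * r.den := by omega
      exact Nat.le_of_mul_le_mul_right this r.den_pos
    have h5 := hI i hiI
    have h6 : ⌊L (k₀ + i * r.den)⌋ = M + i * r.num + b := by linarith
    change ⌊L (k₀ + i * r.den)⌋ = _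
    rw [h6, eq_comm, add_div, ← hya, hint, Int.floor_eq_iff, hqe]
    have hq1 : (1 : ℝ) ≤ r.den := by exact_mod_cast r.den_pos
    rcases hb with rfl | rfl
    · push_cast
      have h7 : (1 + 2 * 0 : ℝ) / 2 / r.den ≤ 1 / 2 := by
        rw [div_le_iff₀ hq']
        linarith
      have h8 : (0 : ℝ) ≤ (1 + 2 * 0 : ℝ) / 2 / r.den := by positivity
      constructor <;> linarith
    · push_cast
      have h7 : (1 + 2 * -1 : ℝ) / 2 / r.den < 0 := div_neg_of_neg_of_pos (by norm_num) hq'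
      have h8 : (-1 : ℝ) ≤ (1 + 2 * -1 : ℝ) / 2 / r.den := by
        rw [le_div_iff₀ hq']
        linarith
      constructor <;> linarith
  · rw [floor_half hq hb hdvd, ← hya]
    refine hfl k fun N hN => hdvd ⟨N, ?_⟩
    rw [hya, div_eq_iff (by rw [hqe]; exact hq'.ne')] at hN
    rw [mul_comm (r.den : ℤ) N]
    exact_mod_cast hN

end rational

/-! ### Lines on the torus -/

/-- The line on the torus that starts from `(a, h)` with velocity `(1, ξ)`. -/
noncomputable def torusLine (ξ a h t : ℝ) : Torus :=
  (((a + t * 1 : ℝ) : UnitAddCircle), ((h + t * 1 * ξ : ℝ) : UnitAddCircle))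

theorem isTorusTrajectory_torusLine (ξ a h : ℝ) : IsTorusTrajectory ξ (torusLine ξ a h) :=
  ⟨a, h, 1, one_pos, fun _ => rfl⟩

theorem coe_eq_zero_iff_int (x : ℝ) : (x : UnitAddCircle) = 0 ↔ ∃ N : ℤ, x = N := by
  rw [AddCircle.coe_eq_zero_iff]
  simp [eq_comm]

theorem torusLine_mem_A {ξ a h t : ℝ} :
    torusLine ξ a h t ∈ torusEdge Letter.A ↔ ∃ N : ℤ, a + t = N := by
  rw [← coe_eq_zero_iff_int, ← mul_one t]
  simp only [mul_one]
  change ((a + t * 1 : ℝ) : UnitAddCircle) = 0 ↔ _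
  rw [mul_one]

theorem torusLine_mem_B {ξ a h t : ℝ} :
    torusLine ξ a h t ∈ torusEdge Letter.B ↔ ∃ N : ℤ, h + t * ξ = N := by
  rw [← coe_eq_zero_iff_int]
  change ((h + t * 1 * ξ : ℝ) : UnitAddCircle) = 0 ↔ _
  rw [mul_one]

theorem torusLine_add (ξ a h t u : ℝ) :
    torusLine ξ a h (t + u) = torusLine ξ (a + t) (h + t * ξ) u := by
  unfold torusLine
  refine Prod.ext ?_ ?_
  · exact congrArg (fun x : ℝ => (x : UnitAddCircle))
      (show a + (t + u) * 1 = a + t + u * 1 by ring)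
  · exact congrArg (fun x : ℝ => (x : UnitAddCircle))
      (show h + (t + u) * 1 * ξ = h + t * ξ + u * 1 * ξ by ring)

theorem torusLine_periodic (r : ℚ) (a h t : ℝ) :
    torusLine r a h (t + r.den) = torusLine r a h t := by
  have hq' : (r.den : ℝ) ≠ 0 := by exact_mod_cast r.den_pos.ne'
  unfold torusLine
  refine Prod.ext ?_ ?_
  · change ((a + (t + r.den) * 1 : ℝ) : UnitAddCircle) = ((a + t * 1 : ℝ) : UnitAddCircle)
    rw [← sub_eq_zero, ← AddCircle.coe_sub, coe_eq_zero_iff_int]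
    exact ⟨r.den, by push_cast; ring⟩
  · change ((h + (t + r.den) * 1 * r : ℝ) : UnitAddCircle) = ((h + t * 1 * r : ℝ) : UnitAddCircle)
    rw [← sub_eq_zero, ← AddCircle.coe_sub, coe_eq_zero_iff_int]
    refine ⟨r.num, ?_⟩
    rw [Rat.cast_def r]
    field_simp
    ring

theorem torusLine_legs {ξ a h : ℝ} (ha : 0 ≤ a) (ha1 : a < 1)
    (hn : ∀ k : ℕ, NonInt (h + (1 - a) * ξ + k * ξ)) :
    ∃ T, Legs (fun u L => torusLine ξ a h u ∈ torusEdge L) T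
      (counts (cnt h (h + (1 - a) * ξ)) fun k => ⌊h + (1 - a) * ξ + k * ξ⌋) := by
  obtain ⟨T, hT0, hT_succ⟩ : ∃ T : ℕ → ℝ, T 0 = 0 ∧ ∀ k : ℕ, T (k + 1) = (1 - a) + k :=
    ⟨fun k => if k = 0 then 0 else (1 - a) + (k - 1), by simp, fun k => by simp⟩
  have hTlt : ∀ k, T k < T (k + 1) := fun k => by
    cases k with
    | zero => rw [hT_succ, hT0]; push_cast; linarith
    | succ k => rw [hT_succ, hT_succ]; push_cast; linarith
  have hTtop : Tendsto T atTop atTop := by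
    rw [← tendsto_add_atTop_iff_nat 1]
    simp_rw [hT_succ]
    exact tendsto_atTop_add_const_left _ _ tendsto_natCast_atTop_atTop
  have hTa : ∀ k : ℕ, (k : ℝ) ≤ a + T k := fun k => by
    cases k with
    | zero => rw [hT0]; push_cast; linarith
    | succ k => rw [hT_succ]; push_cast; linarith
  have hset : ∀ k, {u ∈ Ioo (T k) (T (k + 1)) | torusLine ξ a h u ∈ torusEdge Letter.B} =
      {u ∈ Ioo (T k) (T (k + 1)) | ∃ N : ℤ, (h + T k * ξ) + (u - T k) * ξ = N} := by
    intro k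
    ext u
    refine and_congr_right fun hu => ?_
    rw [torusLine_mem_B, show (h + T k * ξ) + (u - T k) * ξ = h + u * ξ by ring]
  have hYend : ∀ k, (h + T k * ξ) + (T (k + 1) - T k) * ξ = h + (1 - a) * ξ + k * ξ := fun k => by
    rw [hT_succ]; ring
  have hlev := fun k => affine_levels (hTlt k) (H := h + T k * ξ) (σ := ξ)
    (by rw [hYend]; exact hn k)
  refine ⟨T, hT0, strictMono_nat_of_lt_succ hTlt, exists_mem_leg hT0 hTtop, fun k L => ?_,
    fun k u hu => ?_, fun k => ?_, fun k => ?_⟩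
  · cases L
    · rw [torusLine_mem_A, hT_succ]
      simp only [iff_true]
      exact ⟨k + 1, by push_cast; ring⟩
    · rw [torusLine_mem_B, hT_succ]
      simp only [reduceCtorEq, iff_false]
      rintro ⟨N, hN⟩
      exact hn k N (by rw [← hN]; ring)
  · rw [torusLine_mem_A]
    rintro ⟨N, hN⟩
    have h1 : (k : ℝ) < N := by linarith [hTa k, hu.1]
    have h2 : (N : ℝ) < k + 1 := by
      have := hu.2
      rw [hT_succ] at this
      linarith
    have h1' : (k : ℤ) < N := by exact_mod_cast h1
    have h2' : N < k + 1 := by exact_mod_cast h2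
    omega
  · rw [hset]
    exact (hlev k).1
  · rw [hset, (hlev k).2, hYend]
    cases k with
    | zero => simp [counts, hT0]
    | succ k =>
      have : h + T (k + 1) * ξ = h + (1 - a) * ξ + k * ξ := by rw [hT_succ]; ring
      rw [this, cnt_eq_natAbs (hn k) (hn (k + 1))]
      rfl

/-- The cutting sequence for a periodic system of events is periodic. -/
theorem cut_periodic {E : ℝ → Letter → Prop} {d : ℕ → Letter} {q : ℝ} (hq : 0 < q)
    (hE : ∀ u L, E (u + q) L ↔ E u L) (hd : Cut E d) :
    ∃ P, 0 < P ∧ ∀ j, d (j + P) = d j := by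
  obtain ⟨t, ht, hr, hl⟩ := hd
  have hev : ∀ j, 0 < t j ∧ ∃ L, E (t j) L := fun j => (hr _).1 (mem_range_self j)
  have hevq : ∀ j, t j + q ∈ range t := fun j => (hr _).2 ⟨by linarith [(hev j).1], by
    obtain ⟨L, hL⟩ := (hev j).2
    exact ⟨L, (hE _ _).2 hL⟩⟩
  obtain ⟨P, hP⟩ := hevq 0
  refine ⟨P, ht.lt_iff_lt.1 (by rw [hP]; linarith), ?_⟩
  -- Both sequences list increasingly the events from the time `t 0 + q` on.
  have heq : (fun j => t (j + P)) = fun j => t j + q := by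
    refine (StrictMono.range_inj (fun i j hij => ht (by omega)) (fun i j hij => ?_)).1 ?_
    · simpa using ht hij
    · ext u
      constructor
      · rintro ⟨j, rfl⟩
        have h1 : t P ≤ t (j + P) := ht.monotone (by omega)
        obtain ⟨L, hL⟩ := (hev (j + P)).2
        obtain ⟨i, hi⟩ := (hr (t (j + P) - q)).2 ⟨by linarith [(hev 0).1], L, by
          rw [← hE, sub_add_cancel]; exact hL⟩
        exact ⟨i, by simp only [hi]; ring⟩
      · rintro ⟨j, rfl⟩
        obtain ⟨i, hi⟩ := hevq j
        have : P ≤ i := ht.le_iff_le.1 (by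
          rw [hi, hP]
          linarith [ht.monotone (Nat.zero_le j)])
        exact ⟨i - P, by simp only [Nat.sub_add_cancel this, hi]⟩
  intro j
  rw [← hl, show t (j + P) = t j + q from congrFun heq j, hE, hl]

/-! ### The two cases of the theorem -/

section main

variable {s m : ℝ} {τ : ℝ → XPlus s} {c : ℕ → Letter}

/-- A tail of `c` is the cutting sequence of a torus line. To have `c` and `d` agree at equal
indices, periodicity of this tail is used to choose a suitable later starting point on the line. -/
theorem eventually_rational_cutting (hs0 : 0 < s) (hs1 : s < 1)
    (hτ : IsForwardTrajectory s m τ) (hc : IsCuttingSequence (edge s) τ c) {r : ℚ}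
    (h1 : deltaMinus s r ≤ m) (h2 : m ≤ deltaPlus s r) :
    ∃ d, IsTorusCuttingSequence (r : ℝ) d ∧ ∀ᶠ j in atTop, c j = d j := by
  obtain ⟨x₀, y₀, -, -, -, -, hL, T, hT⟩ := exists_legs hs0 hs1 hτ
  obtain ⟨z, hz, K, hK⟩ := exists_eventually_floor_eq hs0 hs1 h1 h2 hL
  obtain ⟨t, ht, hr, hl⟩ := hc
  obtain ⟨i, hi⟩ := (hr (T (K + 1))).2
    ⟨(hT.pos K).trans_lt (hT.mono (Nat.lt_succ_self K)), Letter.A, (hT.endA K _).2 rfl⟩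
  have hcut := cut_shift (E := fun u L => τ u ∈ edge s L) ht hr hl i
  rw [hi] at hcut
  have hend : ∀ k : ℕ, z + K * r + (1 - 0) * r + k * r = z + ((k + (K + 1) : ℕ) : ℝ) * r :=
    fun k => by push_cast; ring
  obtain ⟨T', hT'⟩ := torusLine_legs (ξ := r) (a := 0) (h := z + K * r) le_rfl one_pos
    (fun k => by rw [hend]; exact hz _)
  have hcount : (fun k => counts (cnt y₀ (y₀ + (1 - x₀) * m))
      (fun k => ⌊(returnLift s m)^[k] (y₀ + (1 - x₀) * m)⌋) (k + (K + 1))) =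
      counts (cnt (z + K * r) (z + K * r + (1 - 0) * r))
        fun k => ⌊z + K * r + (1 - 0) * r + k * r⌋ := by
    have hpos : ∀ k : ℕ, K ≤ k → counts (cnt y₀ (y₀ + (1 - x₀) * m))
        (fun k => ⌊(returnLift s m)^[k] (y₀ + (1 - x₀) * m)⌋) (k + 1) =
        (⌊z + ((k + 1 : ℕ) : ℝ) * r⌋ - ⌊z + k * r⌋).natAbs := fun k hk => by
      simp only [counts]
      rw [hK _ hk, hK _ (Nat.le_succ_of_le hk)]
    funext k
    rw [← add_assoc, hpos (k + K) (by omega)]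
    cases k with
    | zero =>
      have : z + K * r + (1 - 0) * r = z + ((K + 1 : ℕ) : ℝ) * r := by push_cast; ring
      simp only [counts]
      rw [this, cnt_eq_natAbs (hz K) (hz (K + 1)), zero_add]
    | succ k =>
      simp only [counts]
      rw [hend, hend, show k + 1 + (K + 1) = k + 1 + K + 1 by ring,
        show k + (K + 1) = k + 1 + K by ring]
  have hd := (hT.shift (K + 1)).cut (hcount ▸ hT') hcut
  obtain ⟨P, hP, hper⟩ := cut_periodic (q := r.den) (by exact_mod_cast r.den_pos)
    (fun u L => by rw [torusLine_periodic]) hd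
  have hper' : ∀ n j, c (j + n * P + (i + 1)) = c (j + (i + 1)) := fun n j => by
    induction n with
    | zero => simp
    | succ n ih => rw [← ih, ← hper (j + n * P)]; congr 1; ring
  obtain ⟨t', ht', hr', hl'⟩ := hd
  have hle : i + 1 ≤ (i + 1) * P := Nat.le_mul_of_pos_right _ hP
  obtain ⟨R, hR⟩ := Nat.exists_eq_add_of_le hle
  -- `R + P` letters are dropped. With the `i + 1` already dropped from `c`, the total offset is `(i
  -- + 2) * P`, a whole number of periods.
  have hcut' := cut_shift (E := fun u L => torusLine r 0 (z + K * r) u ∈ torusEdge L) ht' hr' hl'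
    (R + P - 1)
  simp_rw [torusLine_add] at hcut'
  refine ⟨_, ⟨_, isTorusTrajectory_torusLine _ _ _, Or.inl hcut'⟩, ?_⟩
  filter_upwards [eventually_ge_atTop (i + 1)] with j hj
  obtain ⟨l, rfl⟩ := Nat.exists_eq_add_of_le hj
  rw [add_comm (i + 1) l, ← hper' (i + 1 + 1) l]
  congr 1
  rw [add_mul (i + 1), hR]
  omega

/-- After the first leg the counts agree by shadowing. The torus line must also have the right
number of `B`s before its first `A`, which is arranged through its starting height `h`: it has to
lie at most one leg before the arrival height `y`. -/
theorem irrational_cutting (hs0 : 0 < s) (hs1 : s < 1)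
    (hτ : IsForwardTrajectory s m τ) (hc : IsCuttingSequence (edge s) τ c) {ξ : ℝ}
    (hξ : Irrational ξ) (hm0 : m ≠ 0) (h1 : deltaMinus s ξ ≤ m) (h2 : m ≤ deltaPlus s ξ) :
    IsTorusCuttingSequence ξ c := by
  obtain ⟨x₀, y₀, hx, hy, hmpos, hmneg, hL, T, hT⟩ := exists_legs hs0 hs1 hτ
  obtain ⟨y, hph⟩ := exists_phase hs0 hs1 h1 h2 hL
  have hyn : ∀ k : ℕ, NonInt (y + k * ξ) := fun k =>
    nonInt_of_shadow hs0 hs1 h1 h2 (hL k) (hph k).1 (hph k).2 hξ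
  have hfl : ∀ k : ℕ, ⌊(returnLift s m)^[k] (y₀ + (1 - x₀) * m)⌋ = ⌊y + k * ξ⌋ := fun k =>
    floor_eq_of_shadow hs0 hs1 h1 h2 (hL k) (hph k).1 (hph k).2 (hyn k)
  simp_rw [hfl] at hT
  have hy0 : NonInt y := by simpa using hyn 0
  have hfl0 : ⌊y₀ + (1 - x₀) * m⌋ = ⌊y⌋ := by simpa using hfl 0
  have hL0 : NonInt (y₀ + (1 - x₀) * m) := hL 0
  have hlow : ∀ z < y, phi s m ξ z ≤ y₀ + (1 - x₀) * m := by simpa using (hph 0).1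
  have hup : ∀ z > y, y₀ + (1 - x₀) * m ≤ phi s m ξ z := by simpa using (hph 0).2
  have hphi0 : phi s m ξ 0 = 0 := by
    have : m = deltaMinus s ξ := le_antisymm (deltaMinus_eq_deltaPlus hs0 hs1 hξ ▸ h2) h1
    rw [phi_zero hs0 hs1, ← this, sub_self, mul_zero]
  have hphiξ : ∀ w, phi s m ξ (w + ξ) = (1 - s) * ⌊w⌋ + s * phi s m ξ w + s * m :=
    phi_add_self hs0 hs1
  -- a torus line through the phase with the right number of crossings on its first leg
  have hfinish : ∀ h, cnt h y = cnt y₀ (y₀ + (1 - x₀) * m) → 0 < (y - h) / ξ → (y - h) / ξ ≤ 1 →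
      IsTorusCuttingSequence ξ c := by
    intro h hcnt ha ha'
    have hend : h + (1 - (1 - (y - h) / ξ)) * ξ = y := by
      rw [sub_sub_cancel, div_mul_cancel₀ _ hξ.ne_zero]
      ring
    obtain ⟨T', hT'⟩ := torusLine_legs (ξ := ξ) (a := 1 - (y - h) / ξ) (h := h) (by linarith)
      (by linarith) (by rw [hend]; exact hyn)
    rw [hend, hcnt] at hT'
    exact ⟨_, isTorusTrajectory_torusLine _ _ _, Or.inl (hT.cut hT' hc)⟩
  rcases hξ.ne_zero.lt_or_gt with hneg | hpos
  · have hm : m < 0 := by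
      have h3 := h2.trans (deltaPlus_le_deltaMinus hs0 hs1 hneg)
      rw [deltaMinus_zero] at h3
      exact h3.lt_of_ne hm0
    have hy₀ := hmneg hm
    have hLle : y₀ + (1 - x₀) * m ≤ y₀ := by nlinarith [hx.2]
    have hLgt : s * m < y₀ + (1 - x₀) * m := by nlinarith [hx.1]
    -- If `y ≤ ξ`, then `L ≤ phi (w + ξ) = s * phi w + s * m` for small `w > 0`; letting `w` tend to
    -- 0 contradicts `s * m < L`.
    have hyξ : ξ < y := by
      have ht := (tendsto_phi_zero (m := m) hs0 hs1 hξ).mono_left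
        (nhdsWithin_le_nhds (s := Ioi 0))
      rw [hphi0] at ht
      have hev := ht.eventually_lt_const
        (show 0 < (y₀ + (1 - x₀) * m - s * m) / s from div_pos (by linarith) hs0)
      obtain ⟨w, hw1, hw2⟩ := (hev.and (Ioo_mem_nhdsGT one_pos)).exists
      have hw3 : ⌊w⌋ = 0 := Int.floor_eq_zero_iff.2 ⟨hw2.1.le, hw2.2⟩
      by_contra hcon
      have h3 := hup (w + ξ) (by linarith [hw2.1, not_lt.1 hcon])
      rw [hphiξ, hw3] at h3
      rw [lt_div_iff₀ hs0] at hw1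
      push_cast at h3
      linarith
    have hylt : y < 1 := by
      have h3 : y₀ + (1 - x₀) * m < 1 :=
        (hLle.trans hy.2).lt_of_ne (by exact_mod_cast hL0 1)
      have h4 : ⌊y⌋ < 1 := by
        rw [← hfl0]
        exact Int.floor_lt.2 (by exact_mod_cast h3)
      exact_mod_cast Int.floor_lt.1 h4
    have hh : y < min (y - ξ) 1 := lt_min (by linarith) hylt
    have hh0 : 0 < min (y - ξ) 1 := lt_min (by linarith) one_pos
    have hc1 : ∀ x : ℝ, 0 < x → x ≤ 1 → ⌈x⌉ = 1 := fun x h0 h1 => by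
      rw [Int.ceil_eq_iff]
      push_cast
      constructor <;> linarith
    -- A height in `(0, 1]` gives the same count as `y₀`; the minimum also keeps the first leg no
    -- longer than a full one.
    refine hfinish (min (y - ξ) 1) ?_ (div_pos_of_neg_of_neg (by linarith) hneg) ?_
    · rw [cnt_eq_of_gt hh.le, cnt_eq_of_gt hLle, hfl0, hc1 _ hh0 (min_le_right _ _),
        hc1 _ hy₀ hy.2]
    · rw [div_le_iff_of_neg hneg]
      linarith [min_le_left (y - ξ) 1]
  · have hm : 0 < m := by
      have h3 := (deltaPlus_le_deltaMinus hs0 hs1 hpos).trans h1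
      rw [deltaPlus_zero] at h3
      exact (div_pos (by linarith) hs0).trans_le h3
    have hy₀ := hmpos hm
    have hLge : y₀ ≤ y₀ + (1 - x₀) * m := by nlinarith [hx.2]
    have hLlt : y₀ + (1 - x₀) * m < 1 + s * m := by nlinarith [hx.1]
    -- Otherwise `phi (1 + ξ) = 1 + s * m` would be a lower bound for `L`, which is smaller than
    -- that.
    have hyξ : y ≤ 1 + ξ := by
      by_contra hcon
      have h3 := hlow (1 + ξ) (not_le.1 hcon)
      rw [hphiξ, ← zero_add (1 : ℝ), ← Int.cast_one, phi_add_intCast hs0 hs1, hphi0, zero_add,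
        Int.floor_intCast] at h3
      push_cast at h3
      linarith
    have hfy₀ : ⌊y₀⌋ = 0 := Int.floor_eq_zero_iff.2 ⟨hy.1, hy₀⟩
    have hcX : cnt y₀ (y₀ + (1 - x₀) * m) = ⌊y⌋.toNat := by
      rw [cnt_eq_of_lt hL0 hLge, hfl0, hfy₀, sub_zero]
    have hypos : 0 < y := by
      have h3 : 0 ≤ ⌊y⌋ := by
        rw [← hfl0]
        exact Int.floor_nonneg.2 (by linarith [hy.1])
      exact (Int.floor_nonneg.1 h3).lt_of_ne (by exact_mod_cast (hy0 0).symm)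
    rcases hyξ.lt_or_eq with hlt | heq
    · have hh : max (y - ξ) 0 < y := max_lt (by linarith) hypos
      have hh1 : max (y - ξ) 0 < 1 := max_lt (by linarith) one_pos
      have hf : ⌊max (y - ξ) 0⌋ = 0 := Int.floor_eq_zero_iff.2 ⟨le_max_right _ _, hh1⟩
      refine hfinish (max (y - ξ) 0) ?_ (div_pos (by linarith) hpos) ?_
      · rw [hcX, cnt_eq_of_lt hy0 hh.le, hf, sub_zero]
      · rw [div_le_iff₀ hpos]
        linarith [le_max_left (y - ξ) 0]
    -- If `y = 1 + ξ`, a full leg back from `y` only reaches height 1, whereas a start in `[0, 1)`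
    -- is required. The line from the corner has exactly one `B` fewer on its first leg, and the
    -- letter written in front makes up for it.
    · subst heq
      have hfle : 0 ≤ ⌊ξ⌋ := Int.floor_nonneg.2 hpos.le
      have hf1 : ⌊1 + ξ⌋ = ⌊ξ⌋ + 1 := by rw [add_comm, Int.floor_add_one]
      rw [hcX, hf1] at hT
      obtain ⟨t, ht, hr, hl⟩ := hc
      have hev : ∀ j, 0 < t j ∧ ∃ L, τ (t j) ∈ edge s L := fun j => (hr _).1 (mem_range_self j)
      have hfirst : ∀ u, 0 < u → (∃ L, τ u ∈ edge s L) → t 0 ≤ u := fun u hu he => by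
        obtain ⟨j, rfl⟩ := (hr u).2 ⟨hu, he⟩
        exact ht.monotone (Nat.zero_le j)
      have hB : τ (t 0) ∈ edge s Letter.B := by
        have hcard := hT.card 0
        have hne : {u ∈ Ioo (T 0) (T (0 + 1)) | τ u ∈ edge s Letter.B}.Nonempty := by
          apply nonempty_of_ncard_ne_zero
          rw [hcard]
          simp only [counts]
          omega
        obtain ⟨u, ⟨hu1, hu2⟩, huB⟩ := hne
        rw [hT.zero] at hu1
        have hlt : t 0 < T (0 + 1) := (hfirst u hu1 ⟨_, huB⟩).trans_lt hu2
        obtain ⟨L, hL⟩ := (hev 0).2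
        cases L
        · exact absurd hL (hT.notA 0 _ ⟨by rw [hT.zero]; exact (hev 0).1, hlt⟩)
        · exact hL
      have hcut := cut_shift (E := fun u L => τ u ∈ edge s L) ht hr hl 0
      have hlegs := hT.shift_first (hev 0).1 hB hfirst
      have hn : ∀ k : ℕ, NonInt (0 + (1 - 0) * ξ + k * ξ) := fun k N hN =>
        hyn k (N + 1) (by push_cast; rw [← hN]; ring)
      obtain ⟨T', hT'⟩ := torusLine_legs (ξ := ξ) (a := 0) (h := 0) le_rfl one_pos hn
      have hcount : (fun k => if k = 0 then
            counts (⌊ξ⌋ + 1).toNat (fun k : ℕ => ⌊1 + ξ + k * ξ⌋) 0 - 1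
          else counts (⌊ξ⌋ + 1).toNat (fun k : ℕ => ⌊1 + ξ + k * ξ⌋) k) =
          counts (cnt 0 (0 + (1 - 0) * ξ)) fun k : ℕ => ⌊0 + (1 - 0) * ξ + k * ξ⌋ := by
        funext k
        cases k with
        | zero =>
          have hξn : NonInt ξ := NonInt.of_irrational hξ
          simp only [if_true, counts, sub_zero, one_mul, zero_add]
          rw [cnt_eq_of_lt hξn hpos.le, Int.floor_zero]
          omega
        | succ k =>
          simp only [Nat.succ_ne_zero, if_false, counts, sub_zero, one_mul, zero_add]
          rw [add_assoc 1, add_assoc 1, add_comm 1, add_comm 1, Int.floor_add_one,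
            Int.floor_add_one]
          congr 1
          ring
      refine ⟨_, isTorusTrajectory_torusLine ξ 0 0, Or.inr ⟨hpos, ?_, (hl 0 _).1 hB, ?_⟩⟩
      · simp [torusLine]
      · exact hlegs.cut (hcount ▸ hT') hcut

end main

end HomothetySurface

theorem theorem2 (s : ℝ) (hs0 : 0 < s) (hs1 : s < 1) (m : ℝ)
    (τ : ℝ → HomothetySurface.XPlus s) (c : ℕ → HomothetySurface.Letter)
    (hτ : HomothetySurface.IsForwardTrajectory s m τ)
    (hc : HomothetySurface.IsCuttingSequence (HomothetySurface.edge s) τ c) :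
    (m ∈ HomothetySurface.slopesU s ∪ HomothetySurface.slopesC' s →
      ∃ (r : ℚ) (d : ℕ → HomothetySurface.Letter),
        HomothetySurface.IsTorusCuttingSequence (r : ℝ) d ∧
          ∀ᶠ j in Filter.atTop, c j = d j) ∧
    (m ∈ HomothetySurface.slopesC s \ HomothetySurface.slopesC' s →
      ∃ ξ : ℝ, Irrational ξ ∧ HomothetySurface.IsTorusCuttingSequence ξ c) := by
  constructor
  · intro hm
    obtain ⟨r, h1, h2⟩ := HomothetySurface.exists_rational_rotation hs0 hs1 hm
    exact ⟨r, HomothetySurface.eventually_rational_cutting hs0 hs1 hτ hc h1 h2⟩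
  · intro hm
    obtain ⟨ξ, h1, h2⟩ := HomothetySurface.exists_rotation hs0 hs1 m
    have hξ := HomothetySurface.irrational_of_mem_slopesC hs0 hs1 hm h1 h2
    refine ⟨ξ, hξ, HomothetySurface.irrational_cutting hs0 hs1 hτ hc hξ (fun h0 => ?_) h1 h2⟩
    -- The slope 0 is `Δ⁻(0)`, hence belongs to `C'_s`.
    exact hm.2 ⟨0, Or.inl (by rw [h0, Rat.cast_zero, HomothetySurface.deltaMinus_zero])⟩
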